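/- Let $(\bar M,g,J)$ be a Kaehler manifold, i.e. a Riemannian manifold with Levi-Civita connection $\bar\nabla$ and a smooth $(1,1)$-tensor field $J$ such that $J^2=-I$, $g(JX,JY)=g(X,Y)$ and $\bar\nabla J=0$. Let $M$ be a Riemannian manifold isometrically immersed in $\bar M$, with Levi-Civita connection $\nabla$ and second fundamental form $h$ (the normal component of $\bar\nabla_XY$ for $X,Y$ tangent to $M$). For $X$ tangent to $M$ write $JX=TX+FX$, with $TX$ tangent and $FX$ normal to $M$. Suppose that $M$ is a proper pointwise semi-slant submanifold: $TM=D^T\oplus D^\theta$ is an orthogonal direct sum of smooth distributions of constant ranks $m_1$ and $m_2$; $J D^T=D^T$; there is a function $\theta$ on $M$ such that, at every $p\in M$, the angle between $JX$ and $D^\theta_p$ equals $\theta(p)$ for every nonzero $X\in D^\theta_p$; $m_1\neq 0$; and $\theta$ is not constant. Suppose also that the set of complex points $\{p\in M : \sin\theta(p)=0\}$ has empty interior. Say that a distribution $D$ on $M$ defines a totally geodesic foliation if it is involutive ($[X,Y]\in\Gamma(D)$ for all $X,Y\in\Gamma(D)$) and its leaves have vanishing second fundamental form in $M$ (the component of $\nabla_XY$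 orthogonal to $D$ vanishes for all $X,Y\in\Gamma(D)$). Then: (a) $D^T$ defines a totally geodesic foliation if and only if $$g(h(X,Y),FTV)=g(h(X,JY),FV)\qquad\text{for all } X,Y\in\Gamma(D^T),\ V\in\Gamma(D^\theta).$$ (b) $D^\theta$ defines a totally geodesic foliation if and only if $$g(h(U,X),FTV)=g(h(U,JX),FV)\qquad\text{for all } X\in\Gamma(D^T),\ U,V\in\Gamma(D^\theta).$$ -/

import Mathlib

open Bundle
open scoped Manifold ContDiff

noncomputable section

namespace SemiSlant

instance tangentSpaceFiniteDimensional {E : Type*} [NormedAddCommGroup E] [NormedSpace ℝ E]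
    [FiniteDimensional ℝ E] {M : Type*} [TopologicalSpace M] [ChartedSpace E M] (p : M) :
    FiniteDimensional ℝ (TangentSpace 𝓘(ℝ, E) p) :=
  inferInstanceAs (FiniteDimensional ℝ E)

/-! ### Linear algebra -/

/-- The angle between a vector `v` and a subspace `K`, that is, the angle between `v` and its
orthogonal projection to `K` (for `v ≠ 0` it lies in `[0, π / 2]`, its cosine is `‖P v‖ / ‖v‖`, and
it is `π / 2` when `v` is orthogonal to `K`). -/
def angleToSubspace {V : Type*} [NormedAddCommGroup V] [InnerProductSpace ℝ V]
    (v : V) (K : Submodule ℝ V) [K.HasOrthogonalProjection] : ℝ :=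
  InnerProductGeometry.angle v (K.starProjection v)

section Intrinsic

/-! ### Vector fields, distributions and connections on one Riemannian manifold -/

variable {E : Type*} [NormedAddCommGroup E] [NormedSpace ℝ E] [FiniteDimensional ℝ E]
  {M : Type*} [TopologicalSpace M] [ChartedSpace E M] [IsManifold 𝓘(ℝ, E) ∞ M]

/-- `X` is a smooth vector field on `M`. -/
def IsSmoothField (X : ∀ p : M, TangentSpace 𝓘(ℝ, E) p) : Prop :=
  ContMDiff 𝓘(ℝ, E) 𝓘(ℝ, E).tangent ∞ (fun p ↦ (⟨p, X p⟩ : TangentBundle 𝓘(ℝ, E) M))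

/-- `X` is differentiable at `p`, as a vector field. -/
def IsDiffFieldAt (X : ∀ p : M, TangentSpace 𝓘(ℝ, E) p) (p : M) : Prop :=
  MDifferentiableAt 𝓘(ℝ, E) 𝓘(ℝ, E).tangent (fun q ↦ (⟨q, X q⟩ : TangentBundle 𝓘(ℝ, E) M)) p

/-- `D` is a smooth distribution of rank `m`: a subspace of dimension `m` of each tangent space,
spanned near every point by `m` smooth vector fields. -/
structure IsDistribution (D : ∀ p : M, Submodule ℝ (TangentSpace 𝓘(ℝ, E) p)) (m : ℕ) : Prop where
  finrank_eq : ∀ p, Module.finrank ℝ (D p) = m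
  exists_frame : ∀ p : M, ∃ U : Set M, IsOpen U ∧ p ∈ U ∧
    ∃ s : Fin m → ∀ q : M, TangentSpace 𝓘(ℝ, E) q,
      (∀ i, ContMDiffOn 𝓘(ℝ, E) 𝓘(ℝ, E).tangent ∞
        (fun q ↦ (⟨q, s i q⟩ : TangentBundle 𝓘(ℝ, E) M)) U) ∧
      ∀ q ∈ U, D q = Submodule.span ℝ (Set.range fun i ↦ s i q)

/-- `X ∈ Γ(D)`: a smooth vector field on `M` with values in `D`. -/
def IsSectionOf (D : ∀ p : M, Submodule ℝ (TangentSpace 𝓘(ℝ, E) p))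
    (X : ∀ p : M, TangentSpace 𝓘(ℝ, E) p) : Prop :=
  IsSmoothField X ∧ ∀ p, X p ∈ D p

variable [RiemannianBundle (fun p : M ↦ TangentSpace 𝓘(ℝ, E) p)]

/-- `cov` is the Levi-Civita connection of the Riemannian metric of `M`. As everywhere in Mathlib,
`cov Y p v` is `(∇_v Y)(p)`. -/
structure IsLeviCivita
    (cov : CovariantDerivative 𝓘(ℝ, E) E (fun p : M ↦ TangentSpace 𝓘(ℝ, E) p)) : Prop where
  torsion_free : ∀ (X Y : ∀ p : M, TangentSpace 𝓘(ℝ, E) p) (p : M),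
    IsDiffFieldAt X p → IsDiffFieldAt Y p →
      cov Y p (X p) - cov X p (Y p) = VectorField.mlieBracket 𝓘(ℝ, E) X Y p
  metric : ∀ (Y Z : ∀ p : M, TangentSpace 𝓘(ℝ, E) p) (p : M),
    IsDiffFieldAt Y p → IsDiffFieldAt Z p → ∀ x : TangentSpace 𝓘(ℝ, E) p,
      mvfderiv 𝓘(ℝ, E) (fun q ↦ (inner ℝ (Y q) (Z q) : ℝ)) p x =
        inner ℝ (cov Y p x) (Z p) + inner ℝ (Y p) (cov Z p x)

/-- The second fundamental form of a distribution `D` in `M`: the component of `∇_X Y` orthogonal to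
`D`, for `X, Y ∈ Γ(D)`. If `D` is involutive, this is, at each point, the second fundamental form
in `M` of the leaf of `D` through that point. -/
def distributionSecondForm
    (cov : CovariantDerivative 𝓘(ℝ, E) E (fun p : M ↦ TangentSpace 𝓘(ℝ, E) p))
    (D : ∀ p : M, Submodule ℝ (TangentSpace 𝓘(ℝ, E) p))
    (X Y : ∀ p : M, TangentSpace 𝓘(ℝ, E) p) (p : M) : TangentSpace 𝓘(ℝ, E) p :=
  (D p)ᗮ.starProjection (cov Y p (X p))

/-- `D` defines a totally geodesic foliation of `M`: it is involutive (so that it is the tangent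
distribution of a foliation), and the second fundamental form of its leaves in `M` vanishes. -/
structure IsTotallyGeodesicFoliation
    (cov : CovariantDerivative 𝓘(ℝ, E) E (fun p : M ↦ TangentSpace 𝓘(ℝ, E) p))
    (D : ∀ p : M, Submodule ℝ (TangentSpace 𝓘(ℝ, E) p)) : Prop where
  involutive : ∀ X Y : ∀ p : M, TangentSpace 𝓘(ℝ, E) p, IsSectionOf D X → IsSectionOf D Y →
    ∀ p, VectorField.mlieBracket 𝓘(ℝ, E) X Y p ∈ D p
  totally_geodesic : ∀ X Y : ∀ p : M, TangentSpace 𝓘(ℝ, E) p, IsSectionOf D X → IsSectionOf D Y →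
    ∀ p, distributionSecondForm cov D X Y p = 0

/-- `(M, g, J)`, with `cov` the Levi-Civita connection of `g`, is a Kaehler manifold:
`J` is a smooth tensor field of type `(1,1)` with `J² = -I`, `g(JX, JY) = g(X, Y)` and
`(∇_X J) Y = ∇_X (J Y) - J (∇_X Y) = 0`. -/
structure IsKaehler (J : ∀ p : M, TangentSpace 𝓘(ℝ, E) p →L[ℝ] TangentSpace 𝓘(ℝ, E) p)
    (cov : CovariantDerivative 𝓘(ℝ, E) E (fun p : M ↦ TangentSpace 𝓘(ℝ, E) p)) : Prop where
  smooth : ContMDiff 𝓘(ℝ, E) (𝓘(ℝ, E).prod 𝓘(ℝ, E →L[ℝ] E)) ∞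
    (fun p ↦ (⟨p, J p⟩ : Bundle.TotalSpace (E →L[ℝ] E)
      (fun p : M ↦ TangentSpace 𝓘(ℝ, E) p →L[ℝ] TangentSpace 𝓘(ℝ, E) p)))
  sq : ∀ p (x : TangentSpace 𝓘(ℝ, E) p), J p (J p x) = -x
  isometric : ∀ p (x y : TangentSpace 𝓘(ℝ, E) p), inner ℝ (J p x) (J p y) = inner ℝ x y
  levi_civita : IsLeviCivita cov
  parallel : ∀ (Y : ∀ p : M, TangentSpace 𝓘(ℝ, E) p) (p : M), IsDiffFieldAt Y p →
    ∀ x : TangentSpace 𝓘(ℝ, E) p, cov (fun q ↦ J q (Y q)) p x = J p (cov Y p x)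

end Intrinsic

section Extrinsic

/-! ### Submanifolds

`ι : M → N` is the (isometric) immersion of the submanifold `M` into the ambient manifold `N`. -/

variable {E : Type*} [NormedAddCommGroup E] [NormedSpace ℝ E] [FiniteDimensional ℝ E]
  {E₁ : Type*} [NormedAddCommGroup E₁] [NormedSpace ℝ E₁] [FiniteDimensional ℝ E₁]
  {M : Type*} [TopologicalSpace M] [ChartedSpace E M] [IsManifold 𝓘(ℝ, E) ∞ M]
  {N : Type*} [TopologicalSpace N] [ChartedSpace E₁ N] [IsManifold 𝓘(ℝ, E₁) ∞ N]

/-- The covariant derivative `∇_x Z` of a vector field `Z` along `ι` (a section of `ι^* TN`) in the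
direction `x ∈ T_p M`, for the connection of `ι^* TN` induced by the connection `cov` of `N`:
in the trivialization of `TN` around `ι p`, it is the derivative of the components of `Z` in the
direction `x`, plus the covariant derivative in the direction `dι x` of the vector field with
the constant components of `Z p`. -/
def covAlong (cov : CovariantDerivative 𝓘(ℝ, E₁) E₁ (fun q : N ↦ TangentSpace 𝓘(ℝ, E₁) q))
    (ι : M → N) (Z : ∀ p : M, TangentSpace 𝓘(ℝ, E₁) (ι p)) (p : M) (x : TangentSpace 𝓘(ℝ, E) p) :
    TangentSpace 𝓘(ℝ, E₁) (ι p) :=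
  let e := trivializationAt E₁ (fun q : N ↦ TangentSpace 𝓘(ℝ, E₁) q) (ι p)
  let comp : M → E₁ := fun q ↦ (e ⟨ι q, Z q⟩).2
  e.symm (ι p) (mfderiv 𝓘(ℝ, E) 𝓘(ℝ, E₁) comp p x) +
    cov (fun y ↦ e.symm y (comp p)) (ι p) (mfderiv 𝓘(ℝ, E) 𝓘(ℝ, E₁) ι p x)

variable [RiemannianBundle (fun p : M ↦ TangentSpace 𝓘(ℝ, E) p)]
  [RiemannianBundle (fun q : N ↦ TangentSpace 𝓘(ℝ, E₁) q)]

/-- `ι` is a smooth isometric immersion: it is smooth and the metric of `M` is the induced one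
(so `dι` is injective everywhere). -/
structure IsIsometricImmersion (ι : M → N) : Prop where
  smooth : ContMDiff 𝓘(ℝ, E) 𝓘(ℝ, E₁) ∞ ι
  isometric : ∀ (p : M) (x y : TangentSpace 𝓘(ℝ, E) p),
    inner ℝ (mfderiv 𝓘(ℝ, E) 𝓘(ℝ, E₁) ι p x) (mfderiv 𝓘(ℝ, E) 𝓘(ℝ, E₁) ι p y) = inner ℝ x y

/-- The tangent space `dι (T_p M)` of the submanifold, as a subspace of `T_{ι p} N`. -/
def tangentPlane (ι : M → N) (p : M) : Submodule ℝ (TangentSpace 𝓘(ℝ, E₁) (ι p)) :=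
  (mfderiv 𝓘(ℝ, E) 𝓘(ℝ, E₁) ι p).range

/-- The component of `v ∈ T_{ι p} N` normal to the submanifold. -/
def normalPart (ι : M → N) (p : M) (v : TangentSpace 𝓘(ℝ, E₁) (ι p)) :
    TangentSpace 𝓘(ℝ, E₁) (ι p) :=
  (tangentPlane (E := E) ι p)ᗮ.starProjection v

/-- The second fundamental form `h(X, Y)` of the submanifold, given by the Gauss formula: the normal
component of the ambient covariant derivative of `Y` in the direction `X`. -/
def secondForm (cov : CovariantDerivative 𝓘(ℝ, E₁) E₁ (fun q : N ↦ TangentSpace 𝓘(ℝ, E₁) q))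
    (ι : M → N) (X Y : ∀ p : M, TangentSpace 𝓘(ℝ, E) p) (p : M) : TangentSpace 𝓘(ℝ, E₁) (ι p) :=
  normalPart (E := E) ι p
    (covAlong cov ι (fun q ↦ mfderiv 𝓘(ℝ, E) 𝓘(ℝ, E₁) ι q (Y q)) p (X p))

/-- `T x` for `x ∈ T_p M`: the tangential component of `J x`, as a vector of `T_p M`. For an
isometric `dι`, the adjoint of `dι` is the orthogonal projection to `dι (T_p M)` followed by the
inverse of `dι`. If `J (dι x)` is tangent to the submanifold, `T x` is the vector `J x`. -/
def tanJ (J : ∀ q : N, TangentSpace 𝓘(ℝ, E₁) q →L[ℝ] TangentSpace 𝓘(ℝ, E₁) q) (ι : M → N) (p : M)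
    (x : TangentSpace 𝓘(ℝ, E) p) : TangentSpace 𝓘(ℝ, E) p :=
  LinearMap.adjoint (mfderiv 𝓘(ℝ, E) 𝓘(ℝ, E₁) ι p).toLinearMap
    (J (ι p) (mfderiv 𝓘(ℝ, E) 𝓘(ℝ, E₁) ι p x))

/-- `F x` for `x ∈ T_p M`: the normal component of `J x`. -/
def norJ (J : ∀ q : N, TangentSpace 𝓘(ℝ, E₁) q →L[ℝ] TangentSpace 𝓘(ℝ, E₁) q) (ι : M → N) (p : M)
    (x : TangentSpace 𝓘(ℝ, E) p) : TangentSpace 𝓘(ℝ, E₁) (ι p) :=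
  normalPart (E := E) ι p (J (ι p) (mfderiv 𝓘(ℝ, E) 𝓘(ℝ, E₁) ι p x))

/-- A subspace `K` of `T_p M`, seen as a subspace of `T_{ι p} N`. -/
def pushSubspace (ι : M → N) (p : M) (K : Submodule ℝ (TangentSpace 𝓘(ℝ, E) p)) :
    Submodule ℝ (TangentSpace 𝓘(ℝ, E₁) (ι p)) :=
  K.map (mfderiv 𝓘(ℝ, E) 𝓘(ℝ, E₁) ι p).toLinearMap

instance pushSubspaceFiniteDimensional (ι : M → N) (p : M)
    (K : Submodule ℝ (TangentSpace 𝓘(ℝ, E) p)) :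
    FiniteDimensional ℝ (pushSubspace (E₁ := E₁) ι p K) :=
  inferInstanceAs (FiniteDimensional ℝ (K.map (mfderiv 𝓘(ℝ, E) 𝓘(ℝ, E₁) ι p).toLinearMap))

/-- The submanifold is pointwise semi-slant, with holomorphic distribution `DT` of rank `m₁`,
pointwise slant distribution `Dθ` of rank `m₂`, and slant function `θ`. -/
structure IsPointwiseSemiSlant
    (J : ∀ q : N, TangentSpace 𝓘(ℝ, E₁) q →L[ℝ] TangentSpace 𝓘(ℝ, E₁) q) (ι : M → N)
    (DT Dθ : ∀ p : M, Submodule ℝ (TangentSpace 𝓘(ℝ, E) p)) (m₁ m₂ : ℕ) (θ : M → ℝ) : Prop where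
  distribution_T : IsDistribution DT m₁
  distribution_θ : IsDistribution Dθ m₂
  orthogonal : ∀ p, DT p ⟂ Dθ p
  sup_eq_top : ∀ p, DT p ⊔ Dθ p = ⊤
  holomorphic : ∀ p, (pushSubspace ι p (DT p)).map (J (ι p)).toLinearMap = pushSubspace ι p (DT p)
  slant : ∀ p, ∀ x ∈ Dθ p, x ≠ 0 →
    angleToSubspace (J (ι p) (mfderiv 𝓘(ℝ, E) 𝓘(ℝ, E₁) ι p x)) (pushSubspace ι p (Dθ p)) = θ p

/-- A pointwise semi-slant submanifold is proper if `m₁ ≠ 0` and the slant function is not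
constant. -/
structure IsProperPointwiseSemiSlant
    (J : ∀ q : N, TangentSpace 𝓘(ℝ, E₁) q →L[ℝ] TangentSpace 𝓘(ℝ, E₁) q) (ι : M → N)
    (DT Dθ : ∀ p : M, Submodule ℝ (TangentSpace 𝓘(ℝ, E) p)) (m₁ m₂ : ℕ) (θ : M → ℝ) : Prop
    extends IsPointwiseSemiSlant J ι DT Dθ m₁ m₂ θ where
  rank_ne_zero : m₁ ≠ 0
  not_constant : ¬ ∃ c : ℝ, ∀ p, θ p = c

end Extrinsic

end SemiSlant

end

/-! Everything follows from one pointwise identity. Let `Y` be a section of $D^T$, `V` a section of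
$D^\theta$, `X` any tangent field, and put $a = \bar\nabla_X Y$. As $J$ is parallel and $JY$ is
tangent, $h(X,JY)$ is the normal part of $Ja$. Splitting $JV = TV + FV$ and $JTV = T^2V + FTV$, the
terms $g(Ja,TV)$ and $g(a,JTV)$ cancel by skewness of $J$, and the slant condition $T^2V =
-\cos^2\theta\,V$ leaves $$g(h(X,JY),FV) - g(h(X,Y),FTV) = \sin^2\theta\; g(\nabla_X Y,V).$$ This is
`sin_sq_mul_inner_cov`; it rests on `inner_normal_sub_inner_normal` (linear algebra),
`covAlong_clm_apply` ($J$ is parallel along $\iota$) and `inner_covAlong_mfderiv` (Gauss formula).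

A totally geodesic foliation kills the right side. Conversely, if the left side vanishes, then
$g(\nabla_X Y,V)=0$ off the complex points, hence everywhere by density and continuity
(`continuous_inner_cov`). For (b) the identity is used with the differentiating field in $D^\theta$,
together with $g(\nabla_U X,V) = -g(X,\nabla_U V)$. Involutivity is then automatic, since $\nabla$
is torsion free.

The bulk of the work shows that `covAlong`, given by a formula in one trivialization, is a metric,
torsion free connection along $\iota$. -/

set_option linter.unusedSectionVars false

noncomputable section

namespace SemiSlant

/-! ### Vector fields along `ι`: reduction to constant components, linearity and Leibniz rule -/

section Along

open Filter Topology

variable {E : Type*} [NormedAddCommGroup E] [NormedSpace ℝ E] [FiniteDimensional ℝ E]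
  {E₁ : Type*} [NormedAddCommGroup E₁] [NormedSpace ℝ E₁] [FiniteDimensional ℝ E₁]
  {M : Type*} [TopologicalSpace M] [ChartedSpace E M] [IsManifold 𝓘(ℝ, E) ∞ M]
  {N : Type*} [TopologicalSpace N] [ChartedSpace E₁ N] [IsManifold 𝓘(ℝ, E₁) ∞ N]

/-- A vector field `Z` along `ι` is differentiable at `p`. -/
def DiffAlongAt (ι : M → N) (Z : ∀ p : M, TangentSpace 𝓘(ℝ, E₁) (ι p)) (p : M) : Prop :=
  MDifferentiableAt 𝓘(ℝ, E) 𝓘(ℝ, E₁).tangent (fun q ↦ (⟨ι q, Z q⟩ : TangentBundle 𝓘(ℝ, E₁) N)) p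

/-- The components of a vector field along `ι` in the trivialization of `TN` around `ι p`. -/
def components (ι : M → N) (p : M) (Z : ∀ p : M, TangentSpace 𝓘(ℝ, E₁) (ι p)) (q : M) : E₁ :=
  (trivializationAt E₁ (fun q : N ↦ TangentSpace 𝓘(ℝ, E₁) q) (ι p) ⟨ι q, Z q⟩).2

/-- The vector field with constant components `c` in the trivialization of `TN` around `y₀`. -/
def constField (y₀ : N) (c : E₁) (y : N) : TangentSpace 𝓘(ℝ, E₁) y :=
  (trivializationAt E₁ (fun q : N ↦ TangentSpace 𝓘(ℝ, E₁) q) y₀).symmL ℝ y c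

variable {ι : M → N} {p : M} {Z W : ∀ p : M, TangentSpace 𝓘(ℝ, E₁) (ι p)}

omit [FiniteDimensional ℝ E] [IsManifold 𝓘(ℝ, E) ∞ M] in
lemma mvfderiv_congr {F : Type*} [NormedAddCommGroup F] [NormedSpace ℝ F] {f g : M → F} {p : M}
    (h : f =ᶠ[𝓝 p] g) : mvfderiv 𝓘(ℝ, E) f p = mvfderiv 𝓘(ℝ, E) g p := by
  ext v
  exact congrArg (fun L : E →L[ℝ] F ↦ L v) h.mfderiv_eq

lemma mem_baseSet (y₀ : N) :
    y₀ ∈ (trivializationAt E₁ (fun q : N ↦ TangentSpace 𝓘(ℝ, E₁) q) y₀).baseSet :=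
  FiberBundle.mem_baseSet_trivializationAt' y₀

lemma components_eq_continuousLinearMapAt (q : M)
    (hq : ι q ∈ (trivializationAt E₁ (fun q : N ↦ TangentSpace 𝓘(ℝ, E₁) q) (ι p)).baseSet) :
    components ι p Z q = (trivializationAt E₁ (fun q : N ↦ TangentSpace 𝓘(ℝ, E₁) q)
      (ι p)).continuousLinearMapAt ℝ (ι q) (Z q) := by
  exact (Trivialization.continuousLinearMapAt_apply_of_mem (R := ℝ) _ hq _).symm

lemma constField_components (q : M)
    (hq : ι q ∈ (trivializationAt E₁ (fun q : N ↦ TangentSpace 𝓘(ℝ, E₁) q) (ι p)).baseSet) :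
    constField (ι p) (components ι p Z q) (ι q) = Z q := by
  rw [components_eq_continuousLinearMapAt q hq]
  exact Trivialization.symmL_continuousLinearMapAt _ hq _

lemma components_constField (c : E₁) (q : M)
    (hq : ι q ∈ (trivializationAt E₁ (fun q : N ↦ TangentSpace 𝓘(ℝ, E₁) q) (ι p)).baseSet) :
    components ι p (fun q ↦ constField (ι p) c (ι q)) q = c := by
  rw [components_eq_continuousLinearMapAt q hq]
  exact Trivialization.continuousLinearMapAt_symmL _ hq _

lemma isDiffFieldAt_constField (y₀ : N) (c : E₁) : IsDiffFieldAt (constField y₀ c) y₀ := by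
  unfold IsDiffFieldAt
  rw [mdifferentiableAt_section]
  refine (mdifferentiableAt_const (c := c)).congr_of_eventuallyEq ?_
  filter_upwards [(trivializationAt E₁ (fun q : N ↦ TangentSpace 𝓘(ℝ, E₁) q)
    y₀).open_baseSet.mem_nhds (mem_baseSet y₀)] with y hy
  exact components_constField (ι := (id : N → N)) (p := y₀) c y hy

lemma diffAlongAt_iff : DiffAlongAt (E := E) ι Z p ↔
    MDifferentiableAt 𝓘(ℝ, E) 𝓘(ℝ, E₁) ι p ∧
      MDifferentiableAt 𝓘(ℝ, E) 𝓘(ℝ, E₁) (components ι p Z) p := by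
  unfold DiffAlongAt
  rw [mdifferentiableAt_totalSpace]
  rfl

lemma eventually_mem_baseSet (hι : MDifferentiableAt 𝓘(ℝ, E) 𝓘(ℝ, E₁) ι p) :
    ∀ᶠ q in 𝓝 p, ι q ∈ (trivializationAt E₁ (fun q : N ↦ TangentSpace 𝓘(ℝ, E₁) q)
      (ι p)).baseSet :=
  hι.continuousAt.eventually_mem
    ((trivializationAt E₁ (fun q : N ↦ TangentSpace 𝓘(ℝ, E₁) q) (ι p)).open_baseSet.mem_nhds
      (mem_baseSet _))

lemma components_add_eventuallyEq (hι : MDifferentiableAt 𝓘(ℝ, E) 𝓘(ℝ, E₁) ι p) :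
    components ι p (fun q ↦ Z q + W q) =ᶠ[𝓝 p] components ι p Z + components ι p W := by
  filter_upwards [eventually_mem_baseSet hι] with q hq
  simp only [Pi.add_apply, components_eq_continuousLinearMapAt q hq, map_add]

lemma components_smul_eventuallyEq (hι : MDifferentiableAt 𝓘(ℝ, E) 𝓘(ℝ, E₁) ι p) (f : M → ℝ) :
    components ι p (fun q ↦ f q • Z q) =ᶠ[𝓝 p] f • components ι p Z := by
  filter_upwards [eventually_mem_baseSet hι] with q hq
  simp only [Pi.smul_apply', components_eq_continuousLinearMapAt q hq, map_smul]

lemma DiffAlongAt.add (hZ : DiffAlongAt (E := E) ι Z p) (hW : DiffAlongAt (E := E) ι W p) :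
    DiffAlongAt (E := E) ι (fun q ↦ Z q + W q) p := by
  rw [diffAlongAt_iff] at *
  exact ⟨hZ.1, (hZ.2.add hW.2).congr_of_eventuallyEq (components_add_eventuallyEq hZ.1)⟩

lemma DiffAlongAt.smul {f : M → ℝ} (hf : MDifferentiableAt 𝓘(ℝ, E) 𝓘(ℝ, ℝ) f p)
    (hZ : DiffAlongAt (E := E) ι Z p) : DiffAlongAt (E := E) ι (fun q ↦ f q • Z q) p := by
  rw [diffAlongAt_iff] at *
  exact ⟨hZ.1, (hf.smul hZ.2).congr_of_eventuallyEq (components_smul_eventuallyEq hZ.1 f)⟩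

lemma DiffAlongAt.congr (hZ : DiffAlongAt (E := E) ι Z p) (h : ∀ᶠ q in 𝓝 p, W q = Z q) :
    DiffAlongAt (E := E) ι W p :=
  hZ.congr_of_eventuallyEq (h.mono fun q hq ↦ by simp only [hq])

lemma IsDiffFieldAt.diffAlongAt {S : ∀ y : N, TangentSpace 𝓘(ℝ, E₁) y}
    (hι : MDifferentiableAt 𝓘(ℝ, E) 𝓘(ℝ, E₁) ι p) (hS : IsDiffFieldAt S (ι p)) :
    DiffAlongAt (E := E) ι (fun q ↦ S (ι q)) p :=
  MDifferentiableAt.comp p hS hι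

/-- A property of vector fields along `ι` differentiable at `p` which is local, additive and stable
under multiplication by functions may be checked on the vector fields with constant components. -/
lemma DiffAlongAt.induction {P : (∀ q : M, TangentSpace 𝓘(ℝ, E₁) (ι q)) → Prop}
    (congr : ∀ Z W, DiffAlongAt (E := E) ι Z p → (∀ᶠ q in 𝓝 p, W q = Z q) → P Z → P W)
    (const : ∀ c : E₁, P fun q ↦ constField (ι p) c (ι q))
    (add : ∀ Z W, DiffAlongAt (E := E) ι Z p → DiffAlongAt (E := E) ι W p → P Z → P W →
      P fun q ↦ Z q + W q)
    (smul : ∀ (f : M → ℝ) (Z), MDifferentiableAt 𝓘(ℝ, E) 𝓘(ℝ, ℝ) f p → DiffAlongAt (E := E) ι Z p →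
      P Z → P fun q ↦ f q • Z q)
    (hZ : DiffAlongAt (E := E) ι Z p) : P Z := by
  obtain ⟨hι, hc⟩ := diffAlongAt_iff.1 hZ
  let b := Module.finBasis ℝ E₁
  -- Near `p`, `Z` is the sum of the fields with constant components `b i`, weighted by these
  -- differentiable coefficients.
  let f (i) (q : M) : ℝ := b.equivFunL (components ι p Z q) i
  have hf (i) : MDifferentiableAt 𝓘(ℝ, E) 𝓘(ℝ, ℝ) (f i) p :=
    (((ContinuousLinearMap.proj (R := ℝ) (φ := fun _ : Fin (Module.finrank ℝ E₁) ↦ ℝ) i ∘L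
      (b.equivFunL : E₁ →L[ℝ] (Fin (Module.finrank ℝ E₁) → ℝ)))).mdifferentiableAt
        (x := components ι p Z p)).comp p hc
  have hterm (i) : DiffAlongAt (E := E) ι (fun q ↦ f i q • constField (ι p) (b i) (ι q)) p ∧
      P (fun q ↦ f i q • constField (ι p) (b i) (ι q)) := by
    have h := isDiffFieldAt_constField (ι p) (b i)
    exact ⟨(h.diffAlongAt hι).smul (hf i), smul _ _ (hf i) (h.diffAlongAt hι) (const _)⟩
  have hzero : DiffAlongAt (E := E) ι (fun q ↦ (0 : TangentSpace 𝓘(ℝ, E₁) (ι q))) p ∧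
      P (fun q ↦ (0 : TangentSpace 𝓘(ℝ, E₁) (ι q))) := by
    have h := (isDiffFieldAt_constField (ι p) (0 : E₁)).diffAlongAt hι
    have h0 (q : M) : constField (ι p) (0 : E₁) (ι q) = 0 := map_zero _
    simpa only [h0] using And.intro h (const 0)
  have hsum (s : Finset (Fin (Module.finrank ℝ E₁))) :
      DiffAlongAt (E := E) ι (fun q ↦ ∑ i ∈ s, f i q • constField (ι p) (b i) (ι q)) p ∧
      P (fun q ↦ ∑ i ∈ s, f i q • constField (ι p) (b i) (ι q)) := by
    classical
    induction s using Finset.induction_on with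
    | empty => simpa using hzero
    | insert i s hi ih =>
      simp only [Finset.sum_insert hi]
      exact ⟨(hterm i).1.add ih.1, add _ _ (hterm i).1 ih.1 (hterm i).2 ih.2⟩
  refine congr _ _ (hsum Finset.univ).1 ?_ (hsum Finset.univ).2
  filter_upwards [eventually_mem_baseSet hι] with q hq
  rw [← constField_components (Z := Z) q hq]
  conv_lhs => rw [← b.sum_equivFun (components ι p Z q)]
  simp only [constField, map_sum, map_smul]
  rfl

variable (cov : CovariantDerivative 𝓘(ℝ, E₁) E₁ (fun q : N ↦ TangentSpace 𝓘(ℝ, E₁) q))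

/-- The definition uses the bare inverse `e.symm`. It agrees with `symmL` on the base set, and
connections are local, so it can be traded for `constField`, which is linear in the components. -/
lemma covAlong_eq (x : TangentSpace 𝓘(ℝ, E) p) : covAlong cov ι Z p x =
    constField (ι p) (mvfderiv 𝓘(ℝ, E) (components ι p Z) p x) (ι p) +
      cov (constField (ι p) (components ι p Z p)) (ι p) (mfderiv 𝓘(ℝ, E) 𝓘(ℝ, E₁) ι p x) := by
  set e := trivializationAt E₁ (fun q : N ↦ TangentSpace 𝓘(ℝ, E₁) q) (ι p)
  set c := components ι p Z p
  have hev : ∀ᶠ y in 𝓝 (ι p), constField (ι p) c y = e.symm y c := by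
    filter_upwards [e.open_baseSet.mem_nhds (mem_baseSet (ι p))] with y hy
    exact e.symmL_apply hy c
  have hdiff := isDiffFieldAt_constField (ι p) c
  rw [cov.isCovariantDerivativeOnUniv.congr_of_eventuallyEq hdiff
    (hdiff.congr_of_eventuallyEq (hev.mono fun y hy ↦ by simp only [hy])) Filter.univ_mem hev]
  unfold constField
  rw [e.symmL_apply (mem_baseSet (ι p))]
  rfl

lemma cov_constField_add (y₀ : N) (c d : E₁) :
    cov (constField y₀ (c + d)) y₀ = cov (constField y₀ c) y₀ + cov (constField y₀ d) y₀ := by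
  rw [← cov.isCovariantDerivativeOnUniv.add (isDiffFieldAt_constField y₀ c)
    (isDiffFieldAt_constField y₀ d)]
  congr 1
  ext y
  simp [constField]

lemma cov_constField_smul (y₀ : N) (a : ℝ) (c : E₁) :
    cov (constField y₀ (a • c)) y₀ = a • cov (constField y₀ c) y₀ := by
  rw [← cov.isCovariantDerivativeOnUniv.smul_const a (isDiffFieldAt_constField y₀ c)]
  congr 1
  ext y
  simp [constField]

lemma covAlong_congr (h : ∀ᶠ q in 𝓝 p, W q = Z q) (x : TangentSpace 𝓘(ℝ, E) p) :
    covAlong cov ι W p x = covAlong cov ι Z p x := by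
  have hc : components ι p W =ᶠ[𝓝 p] components ι p Z :=
    h.mono fun q hq ↦ by simp only [components, hq]
  rw [covAlong_eq, covAlong_eq, hc.self_of_nhds, mvfderiv_congr hc]

lemma covAlong_add (hZ : DiffAlongAt (E := E) ι Z p) (hW : DiffAlongAt (E := E) ι W p)
    (x : TangentSpace 𝓘(ℝ, E) p) :
    covAlong cov ι (fun q ↦ Z q + W q) p x = covAlong cov ι Z p x + covAlong cov ι W p x := by
  rw [diffAlongAt_iff] at hZ hW
  have h := components_add_eventuallyEq (Z := Z) (W := W) hZ.1
  have h' : mvfderiv 𝓘(ℝ, E) (components ι p (fun q ↦ Z q + W q)) p x =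
      mvfderiv 𝓘(ℝ, E) (components ι p Z) p x + mvfderiv 𝓘(ℝ, E) (components ι p W) p x := by
    rw [← _root_.add_apply, ← mvfderiv_add hZ.2 hW.2]
    rw [mvfderiv_congr h]
  rw [covAlong_eq, covAlong_eq, covAlong_eq, h', h.self_of_nhds, Pi.add_apply,
    cov_constField_add, _root_.add_apply]
  simp only [constField, map_add]
  abel

lemma covAlong_smul {f : M → ℝ} (hf : MDifferentiableAt 𝓘(ℝ, E) 𝓘(ℝ, ℝ) f p)
    (hZ : DiffAlongAt (E := E) ι Z p) (x : TangentSpace 𝓘(ℝ, E) p) :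
    covAlong cov ι (fun q ↦ f q • Z q) p x =
      f p • covAlong cov ι Z p x + mvfderiv 𝓘(ℝ, E) f p x • Z p := by
  rw [diffAlongAt_iff] at hZ
  have h := components_smul_eventuallyEq (Z := Z) hZ.1 f
  have h' : mvfderiv 𝓘(ℝ, E) (components ι p (fun q ↦ f q • Z q)) p x =
      f p • mvfderiv 𝓘(ℝ, E) (components ι p Z) p x +
        mvfderiv 𝓘(ℝ, E) f p x • components ι p Z p := by
    have := congrArg (· x) (mvfderiv_smul hf hZ.2)
    simp only [_root_.add_apply] at this
    refine Eq.trans ?_ this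
    rw [mvfderiv_congr h]
  have h'' : Z p = constField (ι p) (components ι p Z p) (ι p) :=
    (constField_components p (mem_baseSet _)).symm
  rw [covAlong_eq, covAlong_eq, h', h.self_of_nhds, Pi.smul_apply', cov_constField_smul]
  conv_rhs => rw [h'']
  simp only [constField, map_add, map_smul, _root_.smul_apply, smul_add]
  abel

end Along

/-! ### Restriction of ambient fields and parallel endomorphisms along `ι` -/

section Along

open Filter Topology

variable {E : Type*} [NormedAddCommGroup E] [NormedSpace ℝ E] [FiniteDimensional ℝ E]
  {E₁ : Type*} [NormedAddCommGroup E₁] [NormedSpace ℝ E₁] [FiniteDimensional ℝ E₁]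
  {M : Type*} [TopologicalSpace M] [ChartedSpace E M] [IsManifold 𝓘(ℝ, E) ∞ M]
  {N : Type*} [TopologicalSpace N] [ChartedSpace E₁ N] [IsManifold 𝓘(ℝ, E₁) ∞ N]
  {ι : M → N} {p : M} {Z W : ∀ p : M, TangentSpace 𝓘(ℝ, E₁) (ι p)}
  (cov : CovariantDerivative 𝓘(ℝ, E₁) E₁ (fun q : N ↦ TangentSpace 𝓘(ℝ, E₁) q))

lemma covAlong_constField (hι : MDifferentiableAt 𝓘(ℝ, E) 𝓘(ℝ, E₁) ι p) (c : E₁)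
    (x : TangentSpace 𝓘(ℝ, E) p) :
    covAlong cov ι (fun q ↦ constField (ι p) c (ι q)) p x =
      cov (constField (ι p) c) (ι p) (mfderiv 𝓘(ℝ, E) 𝓘(ℝ, E₁) ι p x) := by
  have h : components ι p (fun q ↦ constField (ι p) c (ι q)) =ᶠ[𝓝 p] fun _ ↦ c := by
    filter_upwards [eventually_mem_baseSet hι] with q hq using components_constField c q hq
  rw [covAlong_eq, mvfderiv_congr h, h.self_of_nhds, mvfderiv_const]
  simp [constField]

/-- Both sides are local and additive in `S`, obey the same Leibniz rule by the chain rule, and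
agree on fields with constant components. -/
lemma covAlong_restrict {S : ∀ y : N, TangentSpace 𝓘(ℝ, E₁) y}
    (hι : MDifferentiableAt 𝓘(ℝ, E) 𝓘(ℝ, E₁) ι p) (hS : IsDiffFieldAt S (ι p))
    (x : TangentSpace 𝓘(ℝ, E) p) :
    covAlong cov ι (fun q ↦ S (ι q)) p x =
      cov S (ι p) (mfderiv 𝓘(ℝ, E) 𝓘(ℝ, E₁) ι p x) := by
  -- A field on `N` is a field along the identity, so the same induction principle applies.
  have hS' : DiffAlongAt (E := E₁) (id : N → N) S (ι p) := hS
  refine hS'.induction (P := fun S ↦ covAlong cov ι (fun q ↦ S (ι q)) p x =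
      cov S (ι p) (mfderiv 𝓘(ℝ, E) 𝓘(ℝ, E₁) ι p x)) ?_ ?_ ?_ ?_
  · intro Z W hZ hW h
    rw [covAlong_congr cov (hι.continuousAt.eventually hW), h,
      cov.isCovariantDerivativeOnUniv.congr_of_eventuallyEq (hZ.congr hW) hZ univ_mem hW]
  · intro c
    exact covAlong_constField cov hι c x
  · intro Z W hZ hW h h'
    rw [covAlong_add cov (IsDiffFieldAt.diffAlongAt hι hZ) (IsDiffFieldAt.diffAlongAt hι hW), h, h']
    exact (congrArg (fun L ↦ L (mfderiv 𝓘(ℝ, E) 𝓘(ℝ, E₁) ι p x))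
      (cov.isCovariantDerivativeOnUniv.add hZ hW)).symm
  · intro f Z hf hZ h
    have hd : mvfderiv 𝓘(ℝ, E) (fun q ↦ f (ι q)) p x =
        mvfderiv 𝓘(ℝ, E₁) f (ι p) (mfderiv 𝓘(ℝ, E) 𝓘(ℝ, E₁) ι p x) :=
      mvfderiv_comp_apply p hf hι x
    rw [covAlong_smul cov (f := fun q ↦ f (ι q)) (hf.comp p hι) (IsDiffFieldAt.diffAlongAt hι hZ),
      h, hd]
    exact (congrArg (fun L ↦ L (mfderiv 𝓘(ℝ, E) 𝓘(ℝ, E₁) ι p x))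
      (cov.isCovariantDerivativeOnUniv.leibniz hZ hf)).symm

lemma DiffAlongAt.clm_apply {J : ∀ q : N, TangentSpace 𝓘(ℝ, E₁) q →L[ℝ] TangentSpace 𝓘(ℝ, E₁) q}
    (hJ : ContMDiff 𝓘(ℝ, E₁) (𝓘(ℝ, E₁).prod 𝓘(ℝ, E₁ →L[ℝ] E₁)) ∞
      (fun p ↦ (⟨p, J p⟩ : Bundle.TotalSpace (E₁ →L[ℝ] E₁)
        (fun p : N ↦ TangentSpace 𝓘(ℝ, E₁) p →L[ℝ] TangentSpace 𝓘(ℝ, E₁) p))))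
    (hZ : DiffAlongAt (E := E) ι Z p) : DiffAlongAt (E := E) ι (fun q ↦ J (ι q) (Z q)) p := by
  have hι := (diffAlongAt_iff.1 hZ).1
  exact MDifferentiableAt.clm_bundle_apply (F₁ := E₁) (F₂ := E₁)
    (ϕ := fun q ↦ J (ι q)) (v := Z)
    (MDifferentiableAt.comp p ((hJ (ι p)).mdifferentiableAt (by simp)) hι) hZ

/-- A parallel endomorphism field commutes with the covariant derivative along `ι`. -/
lemma covAlong_clm_apply
    {J : ∀ q : N, TangentSpace 𝓘(ℝ, E₁) q →L[ℝ] TangentSpace 𝓘(ℝ, E₁) q}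
    (hJ : ContMDiff 𝓘(ℝ, E₁) (𝓘(ℝ, E₁).prod 𝓘(ℝ, E₁ →L[ℝ] E₁)) ∞
      (fun p ↦ (⟨p, J p⟩ : Bundle.TotalSpace (E₁ →L[ℝ] E₁)
        (fun p : N ↦ TangentSpace 𝓘(ℝ, E₁) p →L[ℝ] TangentSpace 𝓘(ℝ, E₁) p))))
    (hpar : ∀ (Y : ∀ p : N, TangentSpace 𝓘(ℝ, E₁) p) (p : N), IsDiffFieldAt Y p →
      ∀ x : TangentSpace 𝓘(ℝ, E₁) p, cov (fun q ↦ J q (Y q)) p x = J p (cov Y p x))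
    (hZ : DiffAlongAt (E := E) ι Z p) (x : TangentSpace 𝓘(ℝ, E) p) :
    covAlong cov ι (fun q ↦ J (ι q) (Z q)) p x = J (ι p) (covAlong cov ι Z p x) := by
  have hι := (diffAlongAt_iff.1 hZ).1
  refine hZ.induction (P := fun Z ↦ covAlong cov ι (fun q ↦ J (ι q) (Z q)) p x =
    J (ι p) (covAlong cov ι Z p x)) ?_ ?_ ?_ ?_
  · intro Z W hZ hW h
    rw [covAlong_congr cov hW, ← h]
    exact covAlong_congr cov (hW.mono fun q hq ↦ by rw [hq]) x
  · intro c
    -- Here both the field and its image under `J` are restrictions of fields on `N`, where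
    -- parallelism is the hypothesis `hpar`.
    have hc := isDiffFieldAt_constField (ι p) c
    have hJc : IsDiffFieldAt (fun y ↦ J y (constField (ι p) c y)) (ι p) :=
      DiffAlongAt.clm_apply (ι := id) hJ hc
    rw [covAlong_restrict cov hι hc, covAlong_restrict cov hι hJc, hpar _ _ hc]
  · intro Z W hZ hW h h'
    simp only [map_add]
    rw [covAlong_add cov (hZ.clm_apply hJ) (hW.clm_apply hJ), covAlong_add cov hZ hW, h, h', map_add]
  · intro f Z hf hZ h
    simp only [map_smul]
    rw [covAlong_smul cov hf (hZ.clm_apply hJ), covAlong_smul cov hf hZ, h, map_add, map_smul,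
      map_smul]

end Along

/-! ### The Lie bracket as a commutator of derivations -/

section Lie

open Filter Topology

variable {E : Type*} [NormedAddCommGroup E] [NormedSpace ℝ E] [FiniteDimensional ℝ E]
  {M : Type*} [TopologicalSpace M] [ChartedSpace E M] [IsManifold 𝓘(ℝ, E) ∞ M]
  {F : Type*} [NormedAddCommGroup F] [NormedSpace ℝ F]

/-- The Lie bracket acts on functions as a commutator. -/
lemma mvfderiv_mlieBracket {f : M → F} {p : M} (hf : ContMDiffAt 𝓘(ℝ, E) 𝓘(ℝ, F) 2 f p)
    {X Y : ∀ p : M, TangentSpace 𝓘(ℝ, E) p} (hX : IsDiffFieldAt X p) (hY : IsDiffFieldAt Y p) :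
    mvfderiv 𝓘(ℝ, E) f p (VectorField.mlieBracket 𝓘(ℝ, E) X Y p) =
      mvfderiv 𝓘(ℝ, E) (fun q ↦ mvfderiv 𝓘(ℝ, E) f q (Y q)) p (X p) -
        mvfderiv 𝓘(ℝ, E) (fun q ↦ mvfderiv 𝓘(ℝ, E) f q (X q)) p (Y p) := by
  let χ := extChartAt 𝓘(ℝ, E) p
  let g : E → F := f ∘ χ.symm
  let V (X : ∀ p : M, TangentSpace 𝓘(ℝ, E) p) : E → E :=
    VectorField.mpullbackWithin 𝓘(ℝ, E) 𝓘(ℝ, E) χ.symm X Set.univ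
  have hp : χ.symm (χ p) = p := extChartAt_to_inv p
  have hg : ContDiffAt ℝ 2 g (χ p) := by
    rw [← contMDiffAt_iff_contDiffAt]
    refine ContMDiffAt.comp (χ p) (hp.symm ▸ hf) ?_
    have := contMDiffWithinAt_extChartAt_symm_range (I := 𝓘(ℝ, E)) (n := 2) p
      (mem_extChartAt_target p)
    rwa [modelWithCornersSelf_coe, Set.range_id, contMDiffWithinAt_univ] at this
  -- Pulling back by `χ.symm` is pushing forward by `χ`, because the two differentials are mutually
  -- inverse.
  have hVeq (X : ∀ p : M, TangentSpace 𝓘(ℝ, E) p) {u : E} (hu : u ∈ χ.target) :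
      V X u = mfderiv 𝓘(ℝ, E) 𝓘(ℝ, E) χ (χ.symm u) (X (χ.symm u)) := by
    have h1 := mfderivWithin_extChartAt_symm_comp_mfderiv_extChartAt (I := 𝓘(ℝ, E)) hu
    have h2 := mfderiv_extChartAt_comp_mfderivWithin_extChartAt_symm (I := 𝓘(ℝ, E)) hu
    have h3 := ContinuousLinearMap.inverse_eq h1 h2
    rw [modelWithCornersSelf_coe, Set.range_id] at h3
    exact congrArg (fun L : E →L[ℝ] E ↦ L (X (χ.symm u))) h3
  have hV {X : ∀ p : M, TangentSpace 𝓘(ℝ, E) p} (hX : IsDiffFieldAt X p) :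
      DifferentiableAt ℝ (V X) (χ p) := by
    have := MDifferentiableWithinAt.differentiableWithinAt_mpullbackWithin_vectorField
      (hX.mdifferentiableWithinAt (s := Set.univ))
    rw [modelWithCornersSelf_coe, Set.range_id, Set.preimage_univ, Set.univ_inter] at this
    exact differentiableWithinAt_univ.1 this
  -- The tangent space at `p` is identified with `E` through the chart at `p`, so this differential
  -- is the identity.
  have hχp : mfderiv 𝓘(ℝ, E) 𝓘(ℝ, E) χ p = ContinuousLinearMap.id ℝ E := mfderiv_extChartAt_self
  have hVp (X : ∀ p : M, TangentSpace 𝓘(ℝ, E) p) : V X (χ p) = X p := by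
    rw [hVeq X (mem_extChartAt_target p)]
    refine (congrArg (fun q ↦ (mfderiv 𝓘(ℝ, E) 𝓘(ℝ, E) χ q (X q) : E)) hp).trans ?_
    exact congrArg (fun L : E →L[ℝ] E ↦ L (X p)) hχp
  have hχ : MDifferentiableAt 𝓘(ℝ, E) 𝓘(ℝ, E) χ p :=
    mdifferentiableAt_extChartAt (mem_chart_source E p)
  have hcomp {k : E → F} (hk : DifferentiableAt ℝ k (χ p)) (v : TangentSpace 𝓘(ℝ, E) p) :
      mvfderiv 𝓘(ℝ, E) (k ∘ χ) p v = fderiv ℝ k (χ p) v := by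
    have h1 : mfderiv 𝓘(ℝ, E) 𝓘(ℝ, F) (k ∘ χ) p v =
        mfderiv 𝓘(ℝ, E) 𝓘(ℝ, F) k (χ p) (mfderiv 𝓘(ℝ, E) 𝓘(ℝ, E) χ p v) :=
      mfderiv_comp_apply p hk.mdifferentiableAt hχ v
    refine h1.trans ?_
    rw [mfderiv_eq_fderiv]
    exact congrArg (fun L : E →L[ℝ] E ↦ fderiv ℝ k (χ p) (L v)) hχp
  have happly (X : ∀ p : M, TangentSpace 𝓘(ℝ, E) p) :
      (fun q ↦ mvfderiv 𝓘(ℝ, E) f q (X q)) =ᶠ[𝓝 p] (fun u ↦ fderiv ℝ g u (V X u)) ∘ χ := by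
    have hf' : ∀ᶠ q in 𝓝 p, MDifferentiableAt 𝓘(ℝ, E) 𝓘(ℝ, F) f q :=
      ((contMDiffAt_iff_contMDiffAt_nhds (by simp)).1 hf).mono
        fun q hq ↦ hq.mdifferentiableAt (by simp)
    have hg' : ∀ᶠ q in 𝓝 p, DifferentiableAt ℝ g (χ q) :=
      (continuousAt_extChartAt p).eventually
        ((hg.eventually (by simp)).mono fun q hq ↦ hq.differentiableAt (by simp))
    have hsrc : ∀ᶠ q in 𝓝 p, q ∈ χ.source := extChartAt_source_mem_nhds p
    filter_upwards [hg', eventually_eventually_nhds.2 hsrc] with q hgq hsq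
    have hq : q ∈ χ.source := hsq.self_of_nhds
    have hfg : f =ᶠ[𝓝 q] g ∘ χ := by
      filter_upwards [hsq] with r hr
      simp only [g, Function.comp_apply, χ.left_inv hr]
    have hχq : MDifferentiableAt 𝓘(ℝ, E) 𝓘(ℝ, E) χ q :=
      mdifferentiableAt_extChartAt (by simpa [χ] using hq)
    have h1 : mfderiv 𝓘(ℝ, E) 𝓘(ℝ, F) (g ∘ χ) q (X q) =
        mfderiv 𝓘(ℝ, E) 𝓘(ℝ, F) g (χ q) (mfderiv 𝓘(ℝ, E) 𝓘(ℝ, E) χ q (X q)) :=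
      mfderiv_comp_apply q hgq.mdifferentiableAt hχq _
    rw [mvfderiv_congr hfg]
    refine h1.trans ?_
    rw [mfderiv_eq_fderiv]
    change fderiv ℝ g (χ q) _ = fderiv ℝ g (χ q) (V X (χ q))
    rw [hVeq X (χ.map_source hq)]
    exact congrArg (fun q' ↦ fderiv ℝ g (χ q) (mfderiv 𝓘(ℝ, E) 𝓘(ℝ, E) χ q' (X q') : E))
      (χ.left_inv hq).symm
  have hg2 : DifferentiableAt ℝ (fderiv ℝ g) (χ p) :=
    (hg.fderiv_right (m := 1) (by norm_num)).differentiableAt (by simp)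
  -- The second-derivative term is symmetric in `X` and `Y`, so it drops out of the commutator; what
  -- remains is `fderiv ℝ g` of the bracket in the chart.
  have hderiv {X Y : ∀ p : M, TangentSpace 𝓘(ℝ, E) p} (hY : IsDiffFieldAt Y p) :
      mvfderiv 𝓘(ℝ, E) (fun q ↦ mvfderiv 𝓘(ℝ, E) f q (Y q)) p (X p) =
        fderiv ℝ (fderiv ℝ g) (χ p) (V X (χ p)) (V Y (χ p)) +
          fderiv ℝ g (χ p) (fderiv ℝ (V Y) (χ p) (V X (χ p))) := by
    rw [mvfderiv_congr (happly Y), hcomp (hg2.clm_apply (hV hY)), fderiv_clm_apply hg2 (hV hY),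
      hVp X]
    exact add_comm _ _
  rw [hderiv hX, hderiv hY]
  have hsymm := (hg.isSymmSndFDerivAt (by simp)) (V X (χ p)) (V Y (χ p))
  rw [hsymm]
  have hbr : VectorField.mlieBracket 𝓘(ℝ, E) X Y p =
      fderiv ℝ (V Y) (χ p) (V X (χ p)) - fderiv ℝ (V X) (χ p) (V Y (χ p)) := by
    rw [← VectorField.mlieBracketWithin_univ, VectorField.mlieBracketWithin_apply]
    simp only [modelWithCornersSelf_coe, Set.range_id, Set.preimage_univ, Set.univ_inter]
    have h : (mfderiv 𝓘(ℝ, E) 𝓘(ℝ, E) χ p).inverse = ContinuousLinearMap.id ℝ E := by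
      refine (congrArg (fun L : E →L[ℝ] E ↦ L.inverse) hχp).trans ?_
      exact ContinuousLinearMap.inverse_id
    refine (congrArg (fun L : E →L[ℝ] E ↦ L _) h).trans ?_
    exact congrFun (VectorField.lieBracketWithin_univ (V := V X) (W := V Y)) (χ p)
  have hfp (v : TangentSpace 𝓘(ℝ, E) p) : mvfderiv 𝓘(ℝ, E) f p v = fderiv ℝ g (χ p) v := by
    rw [← hcomp (hg.differentiableAt (by simp))]
    refine congrArg (fun L : E →L[ℝ] F ↦ L v) (mvfderiv_congr ?_)
    filter_upwards [extChartAt_source_mem_nhds (I := 𝓘(ℝ, E)) p] with r hr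
    simp only [g, Function.comp_apply, χ, (extChartAt 𝓘(ℝ, E) p).left_inv hr]
  rw [hfp, hbr, map_sub]
  abel

end Lie

/-! ### The connection along `ι` is torsion free and metric -/

section Along

open Filter Topology

variable {E : Type*} [NormedAddCommGroup E] [NormedSpace ℝ E] [FiniteDimensional ℝ E]
  {E₁ : Type*} [NormedAddCommGroup E₁] [NormedSpace ℝ E₁] [FiniteDimensional ℝ E₁]
  {M : Type*} [TopologicalSpace M] [ChartedSpace E M] [IsManifold 𝓘(ℝ, E) ∞ M]
  {N : Type*} [TopologicalSpace N] [ChartedSpace E₁ N] [IsManifold 𝓘(ℝ, E₁) ∞ N]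
  {ι : M → N} {p : M} {Z W : ∀ p : M, TangentSpace 𝓘(ℝ, E₁) (ι p)}
  (cov : CovariantDerivative 𝓘(ℝ, E₁) E₁ (fun q : N ↦ TangentSpace 𝓘(ℝ, E₁) q))

lemma IsDiffFieldAt.diffAlongAt_mfderiv (hι : ContMDiff 𝓘(ℝ, E) 𝓘(ℝ, E₁) ∞ ι)
    {Y : ∀ p : M, TangentSpace 𝓘(ℝ, E) p} (hY : IsDiffFieldAt Y p) :
    DiffAlongAt (E := E) ι (fun q ↦ mfderiv 𝓘(ℝ, E) 𝓘(ℝ, E₁) ι q (Y q)) p :=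
  MDifferentiableAt.comp (g := tangentMap 𝓘(ℝ, E) 𝓘(ℝ, E₁) ι) p
    (((hι.contMDiff_tangentMap (m := 1) (by rw [one_add_one_eq_two]; exact ENat.LEInfty.out)) _).mdifferentiableAt (by simp)) hY

lemma components_eq_mvfderiv (q : M) (hq : ι q ∈ (chartAt E₁ (ι p)).source) :
    components ι p Z q = mvfderiv 𝓘(ℝ, E₁) (extChartAt 𝓘(ℝ, E₁) (ι p)) (ι q) (Z q) := by
  rw [components_eq_continuousLinearMapAt q hq,
    TangentBundle.continuousLinearMapAt_trivializationAt hq]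
  rfl

lemma components_mfderiv (hι : ContMDiff 𝓘(ℝ, E) 𝓘(ℝ, E₁) ∞ ι)
    (Y : ∀ p : M, TangentSpace 𝓘(ℝ, E) p) :
    components ι p (fun q ↦ mfderiv 𝓘(ℝ, E) 𝓘(ℝ, E₁) ι q (Y q)) =ᶠ[𝓝 p]
      fun q ↦ mvfderiv 𝓘(ℝ, E) (extChartAt 𝓘(ℝ, E₁) (ι p) ∘ ι) q (Y q) := by
  filter_upwards [eventually_mem_baseSet ((hι p).mdifferentiableAt (by simp))] with q hq
  rw [components_eq_mvfderiv q hq]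
  exact (mfderiv_comp_apply q (mdifferentiableAt_extChartAt hq)
    ((hι q).mdifferentiableAt (by simp)) (Y q)).symm

lemma mvfderiv_extChartAt_injective (y : N) :
    Function.Injective (mvfderiv 𝓘(ℝ, E₁) (extChartAt 𝓘(ℝ, E₁) y) y) := by
  intro v w h
  have h0 : mfderiv 𝓘(ℝ, E₁) 𝓘(ℝ, E₁) (extChartAt 𝓘(ℝ, E₁) y) y = ContinuousLinearMap.id ℝ E₁ :=
    mfderiv_extChartAt_self
  have h1 (v : TangentSpace 𝓘(ℝ, E₁) y) :
      mvfderiv 𝓘(ℝ, E₁) (extChartAt 𝓘(ℝ, E₁) y) y v = v :=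
    congrArg (fun L : E₁ →L[ℝ] E₁ ↦ L v) h0
  rwa [h1, h1] at h

lemma contMDiffAt_extChartAt_self (y : N) :
    ContMDiffAt 𝓘(ℝ, E₁) 𝓘(ℝ, E₁) 2 (extChartAt 𝓘(ℝ, E₁) y) y :=
  contMDiffAt_extChartAt

/-- These are constant combinations of coordinate fields: the chart has constant derivative along
each, so the commutator formula gives zero. -/
lemma mlieBracket_constField (y₀ : N) (c d : E₁) :
    VectorField.mlieBracket 𝓘(ℝ, E₁) (constField y₀ c) (constField y₀ d) y₀ = 0 := by
  apply mvfderiv_extChartAt_injective y₀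
  have hev (c : E₁) : (fun y ↦ mvfderiv 𝓘(ℝ, E₁) (extChartAt 𝓘(ℝ, E₁) y₀) y (constField y₀ c y))
      =ᶠ[𝓝 y₀] fun _ ↦ c := by
    filter_upwards [(trivializationAt E₁ (fun q : N ↦ TangentSpace 𝓘(ℝ, E₁) q)
      y₀).open_baseSet.mem_nhds (mem_baseSet y₀)] with y hy
    exact (components_eq_mvfderiv (ι := (id : N → N)) (p := y₀) (Z := constField y₀ c) y hy).symm.trans
      (components_constField (ι := (id : N → N)) (p := y₀) c y hy)
  rw [mvfderiv_mlieBracket (contMDiffAt_extChartAt_self y₀) (isDiffFieldAt_constField y₀ c)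
    (isDiffFieldAt_constField y₀ d), mvfderiv_congr (hev c), mvfderiv_congr (hev d)]
  simp [mvfderiv_const]

/-- The covariant derivative along `ι` of a torsion free connection is torsion free. -/
lemma covAlong_torsion_free
    (htor : ∀ (X Y : ∀ p : N, TangentSpace 𝓘(ℝ, E₁) p) (p : N),
      IsDiffFieldAt X p → IsDiffFieldAt Y p →
        cov Y p (X p) - cov X p (Y p) = VectorField.mlieBracket 𝓘(ℝ, E₁) X Y p)
    (hι : ContMDiff 𝓘(ℝ, E) 𝓘(ℝ, E₁) ∞ ι) {X Y : ∀ p : M, TangentSpace 𝓘(ℝ, E) p}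
    (hX : IsDiffFieldAt X p) (hY : IsDiffFieldAt Y p) :
    covAlong cov ι (fun q ↦ mfderiv 𝓘(ℝ, E) 𝓘(ℝ, E₁) ι q (Y q)) p (X p) -
        covAlong cov ι (fun q ↦ mfderiv 𝓘(ℝ, E) 𝓘(ℝ, E₁) ι q (X q)) p (Y p) =
      mfderiv 𝓘(ℝ, E) 𝓘(ℝ, E₁) ι p (VectorField.mlieBracket 𝓘(ℝ, E) X Y p) := by
  have hιp : MDifferentiableAt 𝓘(ℝ, E) 𝓘(ℝ, E₁) ι p := (hι p).mdifferentiableAt (by simp)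
  have hconst (Y : ∀ p : M, TangentSpace 𝓘(ℝ, E) p) : constField (ι p)
      (components ι p (fun q ↦ mfderiv 𝓘(ℝ, E) 𝓘(ℝ, E₁) ι q (Y q)) p) (ι p) =
        mfderiv 𝓘(ℝ, E) 𝓘(ℝ, E₁) ι p (Y p) :=
    constField_components (Z := fun q ↦ mfderiv 𝓘(ℝ, E) 𝓘(ℝ, E₁) ι q (Y q)) p (mem_baseSet _)
  -- The connection terms of the two covariant derivatives differ by the bracket of two
  -- constant-component fields, which vanishes.
  have htor' := htor _ _ (ι p) (isDiffFieldAt_constField (ι p)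
    (components ι p (fun q ↦ mfderiv 𝓘(ℝ, E) 𝓘(ℝ, E₁) ι q (X q)) p)) (isDiffFieldAt_constField (ι p)
    (components ι p (fun q ↦ mfderiv 𝓘(ℝ, E) 𝓘(ℝ, E₁) ι q (Y q)) p))
  rw [mlieBracket_constField, hconst X, hconst Y] at htor'
  -- The components of `dι Y` are the derivative of this map along `Y`, so the remaining terms form
  -- a commutator of derivations.
  have hψ : ContMDiffAt 𝓘(ℝ, E) 𝓘(ℝ, E₁) 2 (extChartAt 𝓘(ℝ, E₁) (ι p) ∘ ι) p :=
    (contMDiffAt_extChartAt_self (ι p)).comp p ((hι p).of_le ENat.LEInfty.out)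
  have hbr := mvfderiv_mlieBracket hψ hX hY
  have hcomp := (components_mfderiv (p := p) hι
    (VectorField.mlieBracket 𝓘(ℝ, E) X Y)).self_of_nhds.trans hbr
  rw [covAlong_eq, covAlong_eq, mvfderiv_congr (components_mfderiv hι X),
    mvfderiv_congr (components_mfderiv hι Y), add_sub_add_comm, htor', add_zero,
    ← hconst (VectorField.mlieBracket 𝓘(ℝ, E) X Y), hcomp]
  simp only [constField, map_sub]

variable [RiemannianBundle (fun q : N ↦ TangentSpace 𝓘(ℝ, E₁) q)]
  [IsContMDiffRiemannianBundle 𝓘(ℝ, E₁) ∞ E₁ (fun q : N ↦ TangentSpace 𝓘(ℝ, E₁) q)]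

lemma DiffAlongAt.inner (hZ : DiffAlongAt (E := E) ι Z p) (hW : DiffAlongAt (E := E) ι W p) :
    MDifferentiableAt 𝓘(ℝ, E) 𝓘(ℝ, ℝ) (fun q ↦ (inner ℝ (Z q) (W q) : ℝ)) p :=
  have : IsContMDiffRiemannianBundle 𝓘(ℝ, E₁) 1 E₁ (fun q : N ↦ TangentSpace 𝓘(ℝ, E₁) q) :=
    .of_le (n := ∞) ENat.LEInfty.out
  MDifferentiableAt.inner_bundle (F := E₁) (E := fun q : N ↦ TangentSpace 𝓘(ℝ, E₁) q) hZ hW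

/-- The covariant derivative along `ι` of a metric connection is metric. -/
lemma covAlong_metric
    (hmet : ∀ (Y Z : ∀ p : N, TangentSpace 𝓘(ℝ, E₁) p) (p : N),
      IsDiffFieldAt Y p → IsDiffFieldAt Z p → ∀ x : TangentSpace 𝓘(ℝ, E₁) p,
        mvfderiv 𝓘(ℝ, E₁) (fun q ↦ (inner ℝ (Y q) (Z q) : ℝ)) p x =
          inner ℝ (cov Y p x) (Z p) + inner ℝ (Y p) (cov Z p x))
    (hZ : DiffAlongAt (E := E) ι Z p) (hW : DiffAlongAt (E := E) ι W p)
    (x : TangentSpace 𝓘(ℝ, E) p) :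
    mvfderiv 𝓘(ℝ, E) (fun q ↦ (inner ℝ (Z q) (W q) : ℝ)) p x =
      inner ℝ (covAlong cov ι Z p x) (W p) + inner ℝ (Z p) (covAlong cov ι W p x) := by
  have hι := (diffAlongAt_iff.1 hZ).1
  refine hZ.induction (P := fun Z ↦
    mvfderiv 𝓘(ℝ, E) (fun q ↦ (inner ℝ (Z q) (W q) : ℝ)) p x =
      inner ℝ (covAlong cov ι Z p x) (W p) + inner ℝ (Z p) (covAlong cov ι W p x)) ?_ ?_ ?_ ?_
  · intro Z Z' _ hZZ' h
    rw [covAlong_congr cov hZZ', hZZ'.self_of_nhds, ← h]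
    refine congrArg (fun L : E →L[ℝ] ℝ ↦ L x) (mvfderiv_congr (hZZ'.mono fun q hq ↦ ?_))
    simp only [hq]
  · intro c
    have hc := isDiffFieldAt_constField (ι p) c
    have hc' := hc.diffAlongAt hι
    -- A second induction, now in `W`, reduces to two ambient fields, where the chain rule and
    -- `hmet` suffice.
    refine hW.induction (P := fun W ↦
      mvfderiv 𝓘(ℝ, E) (fun q ↦ (inner ℝ (constField (ι p) c (ι q)) (W q) : ℝ)) p x =
        inner ℝ (covAlong cov ι (fun q ↦ constField (ι p) c (ι q)) p x) (W p) +
          inner ℝ (constField (ι p) c (ι p)) (covAlong cov ι W p x)) ?_ ?_ ?_ ?_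
    · intro W W' _ hWW' h
      rw [covAlong_congr cov hWW', hWW'.self_of_nhds, ← h]
      refine congrArg (fun L : E →L[ℝ] ℝ ↦ L x) (mvfderiv_congr (hWW'.mono fun q hq ↦ ?_))
      simp only [hq]
    · intro d
      have hd := isDiffFieldAt_constField (ι p) d
      rw [covAlong_constField cov hι, covAlong_constField cov hι, ← hmet _ _ _ hc hd]
      exact mvfderiv_comp_apply p (DiffAlongAt.inner (ι := id) hc hd) hι x
    · intro W W' hW hW' h h'
      rw [covAlong_add cov hW hW']
      simp only [inner_add_right]
      rw [mvfderiv_fun_add (hc'.inner hW) (hc'.inner hW'), _root_.add_apply, h, h']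
      ring
    · intro f W hf hW h
      rw [covAlong_smul cov hf hW]
      simp only [inner_add_right, inner_smul_right]
      rw [mvfderiv_fun_mul hf (hc'.inner hW), _root_.add_apply, _root_.smul_apply,
        _root_.smul_apply, h]
      simp only [smul_eq_mul]
      ring
  · intro Z Z' hZ hZ' h h'
    rw [covAlong_add cov hZ hZ']
    simp only [inner_add_left]
    rw [mvfderiv_fun_add (hZ.inner hW) (hZ'.inner hW), _root_.add_apply, h, h']
    ring
  · intro f Z hf hZ h
    rw [covAlong_smul cov hf hZ]
    simp only [inner_add_left, real_inner_smul_left]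
    rw [mvfderiv_fun_mul hf (hZ.inner hW), _root_.add_apply, _root_.smul_apply,
      _root_.smul_apply, h]
    simp only [smul_eq_mul]
    ring

end Along

/-! ### Linear algebra of slant subspaces -/

section LinearAlgebra

variable {V W : Type*} [NormedAddCommGroup V] [InnerProductSpace ℝ V] [FiniteDimensional ℝ V]
  [NormedAddCommGroup W] [InnerProductSpace ℝ W] [FiniteDimensional ℝ W]
  {L : V →ₗ[ℝ] W} {J : W →ₗ[ℝ] W} {H K : Submodule ℝ V}

lemma adjoint_apply_self (hL : ∀ x y, (inner ℝ (L x) (L y) : ℝ) = inner ℝ x y) (x : V) :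
    LinearMap.adjoint L (L x) = x :=
  ext_inner_right ℝ fun y ↦ by rw [LinearMap.adjoint_inner_left, hL]

/-- For an isometric `L`, the composite of `L` with its adjoint is the orthogonal projection onto
the range. -/
lemma starProjection_range_orthogonal (hL : ∀ x y, (inner ℝ (L x) (L y) : ℝ) = inner ℝ x y)
    (w : W) : (L.range)ᗮ.starProjection w = w - L (LinearMap.adjoint L w) := by
  refine Submodule.eq_starProjection_of_mem_orthogonal' (z := L (LinearMap.adjoint L w)) ?_ ?_
    (by abel)
  · rintro _ ⟨y, rfl⟩
    rw [inner_sub_right, hL, LinearMap.adjoint_inner_right, sub_self]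
  · exact Submodule.le_orthogonal_orthogonal _ ⟨_, rfl⟩

lemma inner_map_eq_neg (hJsq : ∀ w, J (J w) = -w)
    (hJ : ∀ x y, (inner ℝ (J x) (J y) : ℝ) = inner ℝ x y) (x y : W) :
    (inner ℝ (J x) y : ℝ) = -inner ℝ x (J y) := by
  rw [← hJ x (J y), hJsq, inner_neg_right, neg_neg]

/-- On a subspace `H` whose image is invariant under `J`, the tangential part of `J` is `J`. -/
lemma map_adjoint_map_of_invariant (hL : ∀ x y, (inner ℝ (L x) (L y) : ℝ) = inner ℝ x y)
    (hH : (H.map L).map J = H.map L) {x : V} (hx : x ∈ H) :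
    L (LinearMap.adjoint L (J (L x))) = J (L x) ∧ LinearMap.adjoint L (J (L x)) ∈ H := by
  have hmem : J (L x) ∈ H.map L := by
    rw [← hH]
    exact Submodule.mem_map_of_mem (Submodule.mem_map_of_mem hx)
  obtain ⟨y, hy, hxy⟩ := hmem
  rw [← hxy, adjoint_apply_self hL]
  exact ⟨rfl, hy⟩

lemma mem_of_forall_inner_eq_zero (hHK : H ⟂ K) (htop : H ⊔ K = ⊤) {v : V}
    (hv : ∀ x ∈ H, (inner ℝ x v : ℝ) = 0) : v ∈ K := by
  obtain ⟨h, hh, k, hk, rfl⟩ := Submodule.mem_sup.1 (htop ▸ Submodule.mem_top : v ∈ H ⊔ K)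
  have h1 : (inner ℝ h k : ℝ) = 0 := hHK.inner_eq hh hk
  have h2 := hv h hh
  rw [inner_add_right, h1, add_zero, inner_self_eq_zero] at h2
  rwa [h2, zero_add]

lemma orthogonal_starProjection_eq_zero_iff (K : Submodule ℝ V) (v : V) :
    Kᗮ.starProjection v = 0 ↔ v ∈ K := by
  rw [Submodule.starProjection_apply_eq_zero_iff, Submodule.orthogonal_orthogonal]

/-- If the angle between `J x` and the slant subspace `K` is constant, then the square of the
tangential part of `J` is multiplication by `-cos² θ` on `K`. -/
lemma adjoint_map_sq_of_slant (hL : ∀ x y, (inner ℝ (L x) (L y) : ℝ) = inner ℝ x y)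
    (hJsq : ∀ w, J (J w) = -w) (hJ : ∀ x y, (inner ℝ (J x) (J y) : ℝ) = inner ℝ x y)
    (hHK : H ⟂ K) (htop : H ⊔ K = ⊤) (hH : (H.map L).map J = H.map L) {θ : ℝ}
    (hslant : ∀ x ∈ K, x ≠ 0 → angleToSubspace (J (L x)) (K.map L) = θ) {v : V} (hv : v ∈ K) :
    LinearMap.adjoint L (J (L (LinearMap.adjoint L (J (L v))))) = -(Real.cos θ ^ 2) • v := by
  set T : V →ₗ[ℝ] V := LinearMap.adjoint L ∘ₗ J ∘ₗ L
  change T (T v) = _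
  have hTinner (x y : V) : (inner ℝ (T x) y : ℝ) = inner ℝ (J (L x)) (L y) :=
    LinearMap.adjoint_inner_left L y (J (L x))
  have hskew (x y : V) : (inner ℝ (T x) y : ℝ) = -inner ℝ x (T y) := by
    rw [hTinner, inner_map_eq_neg hJsq hJ, real_inner_comm, ← hTinner, real_inner_comm]
  -- `T` is skew and preserves `H`, hence preserves the complement `K`.
  have hTK {x : V} (hx : x ∈ K) : T x ∈ K := by
    refine mem_of_forall_inner_eq_zero hHK htop fun y hy ↦ ?_
    have h := hskew y x
    have h0 : (inner ℝ (T y) x : ℝ) = 0 :=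
      hHK.inner_eq (map_adjoint_map_of_invariant hL hH hy).2 hx
    linarith
  have hLnorm (x : V) : ‖L x‖ = ‖x‖ := by
    rw [norm_eq_sqrt_real_inner, norm_eq_sqrt_real_inner, hL]
  have hJnorm (x : W) : ‖J x‖ = ‖x‖ := by
    rw [norm_eq_sqrt_real_inner, norm_eq_sqrt_real_inner, hJ]
  have hnorm {x : V} (hx : x ∈ K) : ‖T x‖ = Real.cos θ * ‖x‖ := by
    rcases eq_or_ne x 0 with rfl | hx0
    · simp
    have hproj : (K.map L).starProjection (J (L x)) = L (T x) := by
      have hmem : L (T x) ∈ K.map L := Submodule.mem_map_of_mem (hTK hx)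
      refine Submodule.eq_starProjection_of_mem_of_inner_eq_zero hmem ?_
      rintro _ ⟨y, -, rfl⟩
      rw [inner_sub_left, hL, hTinner, sub_self]
    have hangle := hslant x hx hx0
    rw [angleToSubspace, hproj] at hangle
    -- If `T x = 0`, the angle with the zero vector is `π / 2` by convention, consistent with `cos θ
    -- = 0`.
    rcases eq_or_ne (T x) 0 with h0 | h0
    · rw [h0, map_zero, InnerProductGeometry.angle_zero_right] at hangle
      rw [h0, ← hangle]
      simp
    · have h := InnerProductGeometry.cos_angle_mul_norm_mul_norm (J (L x)) (L (T x))
      rw [hangle, ← hTinner, real_inner_self_eq_norm_sq, hLnorm, hJnorm, hLnorm] at h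
      have h1 : ‖T x‖ ≠ 0 := norm_ne_zero_iff.2 h0
      apply mul_right_cancel₀ h1
      linarith
  -- Polarization; with skewness it shows that `T (T v) + cos² θ • v`, itself in `K`, is orthogonal
  -- to `K`, hence to itself.
  have hpol {x y : V} (hx : x ∈ K) (hy : y ∈ K) :
      (inner ℝ (T x) (T y) : ℝ) = Real.cos θ ^ 2 * inner ℝ x y := by
    rw [real_inner_eq_norm_add_mul_self_sub_norm_mul_self_sub_norm_mul_self_div_two, ← map_add,
      hnorm hx, hnorm hy, hnorm (K.add_mem hx hy),
      real_inner_eq_norm_add_mul_self_sub_norm_mul_self_sub_norm_mul_self_div_two x y]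
    ring
  set u := T (T v) + (Real.cos θ ^ 2) • v with hu
  have huK : u ∈ K := K.add_mem (hTK (hTK hv)) (K.smul_mem _ hv)
  have hu0 : (inner ℝ u u : ℝ) = 0 := by
    have h1 : (inner ℝ (T (T v)) u : ℝ) = -(Real.cos θ ^ 2 * inner ℝ v u) := by
      rw [hskew, hpol hv huK]
    have h2 : (inner ℝ u u : ℝ) = inner ℝ (T (T v)) u + inner ℝ ((Real.cos θ ^ 2) • v) u :=
      inner_add_left _ _ _
    rw [h2, h1, real_inner_smul_left, neg_add_cancel]
  rw [inner_self_eq_zero] at hu0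
  rw [neg_smul]
  exact eq_neg_of_add_eq_zero_left hu0

/-- The relation between the normal components of a vector `a` and of `J a` and the tangential
component of `a`, for a slant subspace. -/
lemma inner_normal_sub_inner_normal (hL : ∀ x y, (inner ℝ (L x) (L y) : ℝ) = inner ℝ x y)
    (hJsq : ∀ w, J (J w) = -w) (hJ : ∀ x y, (inner ℝ (J x) (J y) : ℝ) = inner ℝ x y)
    (hHK : H ⟂ K) (htop : H ⊔ K = ⊤) (hH : (H.map L).map J = H.map L) {θ : ℝ}
    (hslant : ∀ x ∈ K, x ≠ 0 → angleToSubspace (J (L x)) (K.map L) = θ) {v : V} (hv : v ∈ K)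
    (a : W) :
    (inner ℝ ((L.range)ᗮ.starProjection (J a)) ((L.range)ᗮ.starProjection (J (L v))) : ℝ) -
      inner ℝ ((L.range)ᗮ.starProjection a)
        ((L.range)ᗮ.starProjection (J (L (LinearMap.adjoint L (J (L v)))))) =
      Real.sin θ ^ 2 * inner ℝ a (L v) := by
  -- The normal projection is self-adjoint and idempotent, so it is needed on one side only.
  have hP (x y : W) : (inner ℝ ((L.range)ᗮ.starProjection x) ((L.range)ᗮ.starProjection y) : ℝ) =
      inner ℝ x (y - L (LinearMap.adjoint L y)) := by
    rw [Submodule.inner_starProjection_left_eq_right,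
      Submodule.starProjection_eq_self_iff.2 (Submodule.starProjection_apply_mem _ _),
      starProjection_range_orthogonal hL]
  rw [hP, hP, adjoint_map_sq_of_slant hL hJsq hJ hHK htop hH hslant hv, inner_sub_right,
    inner_sub_right, hJ, inner_map_eq_neg hJsq hJ, map_smul, inner_smul_right, Real.sin_sq]
  ring

end LinearAlgebra

/-! ### Extension of vectors to fields, and continuity of the Levi-Civita connection -/

section Riemannian

open Filter Topology

variable {E : Type*} [NormedAddCommGroup E] [NormedSpace ℝ E] [FiniteDimensional ℝ E]
  {M : Type*} [TopologicalSpace M] [ChartedSpace E M] [IsManifold 𝓘(ℝ, E) ∞ M]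

lemma IsSmoothField.isDiffFieldAt {X : ∀ p : M, TangentSpace 𝓘(ℝ, E) p} (hX : IsSmoothField X)
    (p : M) : IsDiffFieldAt X p :=
  (hX p).mdifferentiableAt (by simp)

lemma exists_isDiffFieldAt (p : M) (v : TangentSpace 𝓘(ℝ, E) p) :
    ∃ X : ∀ p : M, TangentSpace 𝓘(ℝ, E) p, IsDiffFieldAt X p ∧ X p = v := by
  refine ⟨constField p (mvfderiv 𝓘(ℝ, E) (extChartAt 𝓘(ℝ, E) p) p v),
    isDiffFieldAt_constField _ _, ?_⟩
  apply mvfderiv_extChartAt_injective p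
  exact (components_eq_mvfderiv (ι := (id : M → M)) (p := p) (Z := constField p _) p
    (mem_chart_source E p)).symm.trans (components_constField (ι := (id : M → M)) _ p (mem_baseSet p))

/-- A vector of a distribution extends to a global section of the distribution. -/
lemma IsDistribution.exists_isSectionOf [T2Space M]
    {D : ∀ p : M, Submodule ℝ (TangentSpace 𝓘(ℝ, E) p)} {m : ℕ} (hD : IsDistribution D m) {p : M}
    {v : TangentSpace 𝓘(ℝ, E) p} (hv : v ∈ D p) :
    ∃ V : ∀ p : M, TangentSpace 𝓘(ℝ, E) p, IsSectionOf D V ∧ V p = v := by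
  obtain ⟨U, hU, hpU, s, hs, hspan⟩ := hD.exists_frame p
  rw [hspan p hpU, Submodule.mem_span_range_iff_exists_fun] at hv
  obtain ⟨c, rfl⟩ := hv
  -- A bump function supported in the domain of the frame: the product is smooth on `M` and zero,
  -- hence in `D`, off that domain.
  obtain ⟨f, -, hf⟩ := (SmoothBumpFunction.nhds_basis_tsupport (I := 𝓘(ℝ, E)) p).mem_iff.1
    (hU.mem_nhds hpU)
  have hsum : ContMDiffOn 𝓘(ℝ, E) 𝓘(ℝ, E).tangent ∞
      (fun q ↦ (⟨q, ∑ i, c i • s i q⟩ : TangentBundle 𝓘(ℝ, E) M)) U :=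
    ContMDiffOn.sum_section fun i _ ↦ (hs i).const_smul_section (a := c i)
  refine ⟨fun q ↦ f q • ∑ i, c i • s i q, ⟨?_, fun q ↦ ?_⟩, ?_⟩
  · exact ContMDiffOn.smul_section_of_tsupport f.contMDiff.contMDiffOn hU hf hsum
  · by_cases hq : q ∈ U
    · rw [hspan q hq]
      exact Submodule.smul_mem _ _ (Submodule.sum_mem _ fun i _ ↦
        Submodule.smul_mem _ _ (Submodule.subset_span ⟨i, rfl⟩))
    · have h0 : f q = 0 := image_eq_zero_of_notMem_tsupport fun h ↦ hq (hf h)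
      simp only [h0, zero_smul, Submodule.zero_mem]
  · simp only [f.eq_one, one_smul]

lemma IsSmoothField.continuous_mvfderiv {f : M → ℝ} (hf : ContMDiff 𝓘(ℝ, E) 𝓘(ℝ, ℝ) ∞ f)
    {X : ∀ p : M, TangentSpace 𝓘(ℝ, E) p} (hX : IsSmoothField X) :
    Continuous fun p ↦ mvfderiv 𝓘(ℝ, E) f p (X p) := by
  have h1 : Continuous (tangentMap 𝓘(ℝ, E) 𝓘(ℝ, ℝ) f) :=
    (hf.contMDiff_tangentMap (m := 1) (by rw [one_add_one_eq_two]; exact ENat.LEInfty.out)).continuous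
  exact continuous_snd.comp ((tangentBundleModelSpaceHomeomorph 𝓘(ℝ, ℝ)).continuous.comp
    (h1.comp hX.continuous))

variable [RiemannianBundle (fun p : M ↦ TangentSpace 𝓘(ℝ, E) p)]
  [IsContMDiffRiemannianBundle 𝓘(ℝ, E) ∞ E (fun p : M ↦ TangentSpace 𝓘(ℝ, E) p)]

lemma IsSmoothField.contMDiff_inner {X Y : ∀ p : M, TangentSpace 𝓘(ℝ, E) p} (hX : IsSmoothField X)
    (hY : IsSmoothField Y) :
    ContMDiff 𝓘(ℝ, E) 𝓘(ℝ, ℝ) ∞ fun p ↦ (inner ℝ (X p) (Y p) : ℝ) :=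
  ContMDiff.inner_bundle (F := E) (E := fun q : M ↦ TangentSpace 𝓘(ℝ, E) q) hX hY

lemma IsSmoothField.continuous_inner_mlieBracket {X Y Z : ∀ p : M, TangentSpace 𝓘(ℝ, E) p}
    (hX : IsSmoothField X) (hY : IsSmoothField Y) (hZ : IsSmoothField Z) :
    Continuous fun p ↦ (inner ℝ (VectorField.mlieBracket 𝓘(ℝ, E) X Y p) (Z p) : ℝ) := by
  have : IsManifold 𝓘(ℝ, E) (((1 : ℕ∞) : WithTop ℕ∞) + 1) M :=
    .of_le (n := ∞) (WithTop.coe_le_coe.2 (le_top : (1 + 1 : ℕ∞) ≤ ⊤))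
  have : IsManifold 𝓘(ℝ, E) (minSmoothness ℝ 2) M := by
    rw [minSmoothness_of_isRCLikeNormedField]; infer_instance
  have : IsContMDiffRiemannianBundle 𝓘(ℝ, E) ((0 : ℕ∞) : WithTop ℕ∞) E
      (fun q : M ↦ TangentSpace 𝓘(ℝ, E) q) := .of_le (n := ∞) (WithTop.coe_le_coe.2 le_top)
  refine continuous_iff_continuousAt.2 fun p ↦ ?_
  have h {X : ∀ p : M, TangentSpace 𝓘(ℝ, E) p} (hX : IsSmoothField X) :=
    (hX p).of_le (m := ((1 : ℕ∞) : WithTop ℕ∞)) ENat.LEInfty.out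
  have hbr := (h hX).mlieBracket_vectorField (m := 0) (h hY) (by simp)
  have hin : ContMDiffAt 𝓘(ℝ, E) 𝓘(ℝ, ℝ) ((0 : ℕ∞) : WithTop ℕ∞)
      (fun p ↦ (inner ℝ (VectorField.mlieBracket 𝓘(ℝ, E) X Y p) (Z p) : ℝ)) p :=
    ContMDiffAt.inner_bundle (F := E) (E := fun q : M ↦ TangentSpace 𝓘(ℝ, E) q) hbr
      ((hZ p).of_le (WithTop.coe_le_coe.2 le_top))
  exact hin.continuousAt

variable {cov : CovariantDerivative 𝓘(ℝ, E) E (fun p : M ↦ TangentSpace 𝓘(ℝ, E) p)}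

lemma IsLeviCivita.koszul (hcov : IsLeviCivita cov) {X Y Z : ∀ p : M, TangentSpace 𝓘(ℝ, E) p}
    {p : M} (hX : IsDiffFieldAt X p) (hY : IsDiffFieldAt Y p) (hZ : IsDiffFieldAt Z p) :
    2 * (inner ℝ (cov Y p (X p)) (Z p) : ℝ) =
      mvfderiv 𝓘(ℝ, E) (fun q ↦ (inner ℝ (Y q) (Z q) : ℝ)) p (X p) +
      mvfderiv 𝓘(ℝ, E) (fun q ↦ (inner ℝ (X q) (Z q) : ℝ)) p (Y p) -
      mvfderiv 𝓘(ℝ, E) (fun q ↦ (inner ℝ (X q) (Y q) : ℝ)) p (Z p) +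
      inner ℝ (VectorField.mlieBracket 𝓘(ℝ, E) X Y p) (Z p) -
      inner ℝ (VectorField.mlieBracket 𝓘(ℝ, E) X Z p) (Y p) -
      inner ℝ (VectorField.mlieBracket 𝓘(ℝ, E) Y Z p) (X p) := by
  rw [hcov.metric Y Z p hY hZ, hcov.metric X Z p hX hZ, hcov.metric X Y p hX hY,
    ← hcov.torsion_free X Y p hX hY, ← hcov.torsion_free X Z p hX hZ,
    ← hcov.torsion_free Y Z p hY hZ]
  simp only [inner_sub_left]
  linarith [real_inner_comm (Y p) (cov Z p (X p)), real_inner_comm (X p) (cov Z p (Y p)),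
    real_inner_comm (X p) (cov Y p (Z p))]

/-- The Koszul formula expresses the connection through the metric and brackets, so continuity needs
no regularity assumption on `cov`. -/
lemma IsLeviCivita.continuous_inner_cov (hcov : IsLeviCivita cov)
    {X Y Z : ∀ p : M, TangentSpace 𝓘(ℝ, E) p} (hX : IsSmoothField X) (hY : IsSmoothField Y)
    (hZ : IsSmoothField Z) : Continuous fun p ↦ (inner ℝ (cov Y p (X p)) (Z p) : ℝ) := by
  have h : Continuous fun p ↦ 2 * (inner ℝ (cov Y p (X p)) (Z p) : ℝ) := by
    have heq (p : M) := hcov.koszul (hX.isDiffFieldAt p) (hY.isDiffFieldAt p) (hZ.isDiffFieldAt p)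
    simp only [heq]
    exact (((((hX.continuous_mvfderiv (hY.contMDiff_inner hZ)).add
      (hY.continuous_mvfderiv (hX.contMDiff_inner hZ))).sub
      (hZ.continuous_mvfderiv (hX.contMDiff_inner hY))).add
      (hX.continuous_inner_mlieBracket hY hZ)).sub
      (hX.continuous_inner_mlieBracket hZ hY)).sub
      (hY.continuous_inner_mlieBracket hZ hX)
  simpa using h.const_mul (2⁻¹ : ℝ)

end Riemannian

/-! ### The Gauss formula -/

section Gauss

variable {E : Type*} [NormedAddCommGroup E] [NormedSpace ℝ E] [FiniteDimensional ℝ E]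
  {E₁ : Type*} [NormedAddCommGroup E₁] [NormedSpace ℝ E₁] [FiniteDimensional ℝ E₁]
  {M : Type*} [TopologicalSpace M] [ChartedSpace E M] [IsManifold 𝓘(ℝ, E) ∞ M]
  {N : Type*} [TopologicalSpace N] [ChartedSpace E₁ N] [IsManifold 𝓘(ℝ, E₁) ∞ N]
  [RiemannianBundle (fun p : M ↦ TangentSpace 𝓘(ℝ, E) p)]
  [IsContMDiffRiemannianBundle 𝓘(ℝ, E) ∞ E (fun p : M ↦ TangentSpace 𝓘(ℝ, E) p)]
  [RiemannianBundle (fun q : N ↦ TangentSpace 𝓘(ℝ, E₁) q)]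
  [IsContMDiffRiemannianBundle 𝓘(ℝ, E₁) ∞ E₁ (fun q : N ↦ TangentSpace 𝓘(ℝ, E₁) q)]
  {ι : M → N} {covM : CovariantDerivative 𝓘(ℝ, E) E (fun p : M ↦ TangentSpace 𝓘(ℝ, E) p)}
  {covN : CovariantDerivative 𝓘(ℝ, E₁) E₁ (fun q : N ↦ TangentSpace 𝓘(ℝ, E₁) q)}

/-- Gauss formula: the tangential component of the ambient covariant derivative is the covariant
derivative of the submanifold. -/
lemma inner_covAlong_mfderiv (hι : IsIsometricImmersion (E := E) (E₁ := E₁) ι)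
    (hM : IsLeviCivita covM) (hN : IsLeviCivita covN) {Y : ∀ p : M, TangentSpace 𝓘(ℝ, E) p} {p : M}
    (hY : IsDiffFieldAt Y p) (x z : TangentSpace 𝓘(ℝ, E) p) :
    (inner ℝ (covAlong covN ι (fun q ↦ mfderiv 𝓘(ℝ, E) 𝓘(ℝ, E₁) ι q (Y q)) p x)
      (mfderiv 𝓘(ℝ, E) 𝓘(ℝ, E₁) ι p z) : ℝ) = inner ℝ (covM Y p x) z := by
  -- The difference of the two connections: symmetric in `X`, `Y` as both are torsion free, skew in
  -- `Y`, `Z` as both are metric.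
  let a (X Y Z : ∀ p : M, TangentSpace 𝓘(ℝ, E) p) : ℝ :=
    inner ℝ (covAlong covN ι (fun q ↦ mfderiv 𝓘(ℝ, E) 𝓘(ℝ, E₁) ι q (Y q)) p (X p))
      (mfderiv 𝓘(ℝ, E) 𝓘(ℝ, E₁) ι p (Z p)) - inner ℝ (covM Y p (X p)) (Z p)
  have hsymm {X Y : ∀ p : M, TangentSpace 𝓘(ℝ, E) p} (Z : ∀ p : M, TangentSpace 𝓘(ℝ, E) p)
      (hX : IsDiffFieldAt X p) (hY : IsDiffFieldAt Y p) : a X Y Z = a Y X Z := by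
    have h1 := congrArg (fun w ↦ (inner ℝ w (mfderiv 𝓘(ℝ, E) 𝓘(ℝ, E₁) ι p (Z p)) : ℝ))
      (covAlong_torsion_free covN hN.torsion_free hι.smooth hX hY)
    simp only [hι.isometric, ← hM.torsion_free X Y p hX hY, inner_sub_left] at h1
    simp only [a]
    linarith
  have hskew (X : ∀ p : M, TangentSpace 𝓘(ℝ, E) p) {Y Z : ∀ p : M, TangentSpace 𝓘(ℝ, E) p}
      (hY : IsDiffFieldAt Y p) (hZ : IsDiffFieldAt Z p) : a X Y Z = -a X Z Y := by
    have h1 := covAlong_metric covN hN.metric (hY.diffAlongAt_mfderiv hι.smooth)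
      (hZ.diffAlongAt_mfderiv hι.smooth) (X p)
    simp only [hι.isometric, hM.metric Y Z p hY hZ] at h1
    simp only [a]
    linarith [real_inner_comm (Y p) (covM Z p (X p)), real_inner_comm
      (mfderiv 𝓘(ℝ, E) 𝓘(ℝ, E₁) ι p (Y p))
      (covAlong covN ι (fun q ↦ mfderiv 𝓘(ℝ, E) 𝓘(ℝ, E₁) ι q (Z q)) p (X p))]
  obtain ⟨X, hX, rfl⟩ := exists_isDiffFieldAt p x
  obtain ⟨Z, hZ, rfl⟩ := exists_isDiffFieldAt p z
  -- Alternating the two symmetries six times returns to `a X Y Z` with the opposite sign.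
  have h : a X Y Z = 0 := by
    linarith [hskew X hY hZ, hsymm Y hX hZ, hskew Z hX hY, hsymm X hZ hY, hskew Y hZ hX,
      hsymm Z hX hY]
  exact sub_eq_zero.1 h

end Gauss

/-! ### The key identity on pointwise semi-slant submanifolds -/

section SemiSlantSubmanifold

variable {E : Type*} [NormedAddCommGroup E] [NormedSpace ℝ E] [FiniteDimensional ℝ E]
  {E₁ : Type*} [NormedAddCommGroup E₁] [NormedSpace ℝ E₁] [FiniteDimensional ℝ E₁]
  {M : Type*} [TopologicalSpace M] [ChartedSpace E M] [IsManifold 𝓘(ℝ, E) ∞ M]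
  {N : Type*} [TopologicalSpace N] [ChartedSpace E₁ N] [IsManifold 𝓘(ℝ, E₁) ∞ N]
  [RiemannianBundle (fun p : M ↦ TangentSpace 𝓘(ℝ, E) p)]
  [IsContMDiffRiemannianBundle 𝓘(ℝ, E) ∞ E (fun p : M ↦ TangentSpace 𝓘(ℝ, E) p)]
  [RiemannianBundle (fun q : N ↦ TangentSpace 𝓘(ℝ, E₁) q)]
  [IsContMDiffRiemannianBundle 𝓘(ℝ, E₁) ∞ E₁ (fun q : N ↦ TangentSpace 𝓘(ℝ, E₁) q)]
  {ι : M → N} {covM : CovariantDerivative 𝓘(ℝ, E) E (fun p : M ↦ TangentSpace 𝓘(ℝ, E) p)}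
  {covN : CovariantDerivative 𝓘(ℝ, E₁) E₁ (fun q : N ↦ TangentSpace 𝓘(ℝ, E₁) q)}
  {J : ∀ q : N, TangentSpace 𝓘(ℝ, E₁) q →L[ℝ] TangentSpace 𝓘(ℝ, E₁) q}
  {DT Dθ : ∀ p : M, Submodule ℝ (TangentSpace 𝓘(ℝ, E) p)} {m₁ m₂ : ℕ} {θ : M → ℝ}

/-- The second fundamental form of a pointwise semi-slant submanifold determines the component of
`∇_X Y` in the slant distribution, for `Y` in the holomorphic distribution, off the complex
points. -/
lemma IsPointwiseSemiSlant.sin_sq_mul_inner_cov (hD : IsPointwiseSemiSlant J ι DT Dθ m₁ m₂ θ)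
    (hN : IsKaehler J covN) (hι : IsIsometricImmersion (E := E) (E₁ := E₁) ι)
    (hM : IsLeviCivita covM) (X : ∀ p : M, TangentSpace 𝓘(ℝ, E) p)
    {Y : ∀ p : M, TangentSpace 𝓘(ℝ, E) p} (hY : IsSectionOf DT Y) {p : M}
    {v : TangentSpace 𝓘(ℝ, E) p} (hv : v ∈ Dθ p) :
    (inner ℝ (secondForm covN ι X (fun q ↦ tanJ J ι q (Y q)) p) (norJ J ι p v) : ℝ) -
      inner ℝ (secondForm covN ι X Y p) (norJ J ι p (tanJ J ι p v)) =
      Real.sin (θ p) ^ 2 * inner ℝ (covM Y p (X p)) v := by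
  -- An equality of fields, not only at `p`, because the field is about to be differentiated.
  have hfun : (fun q ↦ mfderiv 𝓘(ℝ, E) 𝓘(ℝ, E₁) ι q (tanJ J ι q (Y q))) =
      fun q ↦ J (ι q) (mfderiv 𝓘(ℝ, E) 𝓘(ℝ, E₁) ι q (Y q)) := by
    funext q
    exact (map_adjoint_map_of_invariant (L := (mfderiv 𝓘(ℝ, E) 𝓘(ℝ, E₁) ι q).toLinearMap)
      (J := (J (ι q)).toLinearMap) (hι.isometric q) (hD.holomorphic q) (hY.2 q)).1
  have hYp := hY.1.isDiffFieldAt p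
  have h := inner_normal_sub_inner_normal (L := (mfderiv 𝓘(ℝ, E) 𝓘(ℝ, E₁) ι p).toLinearMap)
    (J := (J (ι p)).toLinearMap) (hι.isometric p) (hN.sq (ι p)) (hN.isometric (ι p))
    (hD.orthogonal p) (hD.sup_eq_top p) (hD.holomorphic p) (hD.slant p) hv
    (covAlong covN ι (fun q ↦ mfderiv 𝓘(ℝ, E) 𝓘(ℝ, E₁) ι q (Y q)) p (X p))
  rw [← inner_covAlong_mfderiv hι hM hN.levi_civita hYp]
  refine Eq.trans ?_ h
  rw [secondForm, hfun, covAlong_clm_apply covN hN.smooth hN.parallel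
    (hYp.diffAlongAt_mfderiv hι.smooth)]
  rfl

/-- The differentiating field `X` is not confined to a distribution: (a) takes it in `DT`, (b) in
`Dθ`. -/
lemma IsPointwiseSemiSlant.inner_cov_eq_zero (hD : IsPointwiseSemiSlant J ι DT Dθ m₁ m₂ θ)
    (hN : IsKaehler J covN) (hι : IsIsometricImmersion (E := E) (E₁ := E₁) ι)
    (hM : IsLeviCivita covM) (hθ : Dense {p : M | Real.sin (θ p) ≠ 0})
    {X Y V : ∀ p : M, TangentSpace 𝓘(ℝ, E) p} (hX : IsSmoothField X) (hY : IsSectionOf DT Y)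
    (hV : IsSectionOf Dθ V)
    (h : ∀ p : M, (inner ℝ (secondForm covN ι X Y p) (norJ J ι p (tanJ J ι p (V p))) : ℝ) =
      inner ℝ (secondForm covN ι X (fun q ↦ tanJ J ι q (Y q)) p) (norJ J ι p (V p))) (p : M) :
    (inner ℝ (covM Y p (X p)) (V p) : ℝ) = 0 := by
  refine congrFun (Continuous.ext_on hθ (hM.continuous_inner_cov hX hY.1 hV.1)
    (continuous_const (y := (0 : ℝ))) fun q hq ↦ ?_) p
  have h1 := hD.sin_sq_mul_inner_cov hN hι hM X hY (hV.2 q)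
  rw [h q, sub_self] at h1
  exact (mul_eq_zero.1 h1.symm).resolve_left (pow_ne_zero 2 hq)

/-- A distribution whose second fundamental form vanishes is involutive. -/
lemma IsLeviCivita.isTotallyGeodesicFoliation (hM : IsLeviCivita covM)
    {D : ∀ p : M, Submodule ℝ (TangentSpace 𝓘(ℝ, E) p)}
    (h : ∀ X Y : ∀ p : M, TangentSpace 𝓘(ℝ, E) p, IsSectionOf D X → IsSectionOf D Y →
      ∀ p, covM Y p (X p) ∈ D p) : IsTotallyGeodesicFoliation covM D where
  involutive X Y hX hY p := by
    rw [← hM.torsion_free X Y p (hX.1.isDiffFieldAt p) (hY.1.isDiffFieldAt p)]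
    exact (D p).sub_mem (h X Y hX hY p) (h Y X hY hX p)
  totally_geodesic X Y hX hY p := (orthogonal_starProjection_eq_zero_iff (D p) _).2 (h X Y hX hY p)

lemma IsTotallyGeodesicFoliation.cov_mem {D : ∀ p : M, Submodule ℝ (TangentSpace 𝓘(ℝ, E) p)}
    (h : IsTotallyGeodesicFoliation covM D) {X Y : ∀ p : M, TangentSpace 𝓘(ℝ, E) p}
    (hX : IsSectionOf D X) (hY : IsSectionOf D Y) (p : M) : covM Y p (X p) ∈ D p :=
  (orthogonal_starProjection_eq_zero_iff (D p) _).1 (h.totally_geodesic X Y hX hY p)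

/-- For orthogonal fields, `g(∇_Z X, Y) = -g(X, ∇_Z Y)`. -/
lemma IsLeviCivita.inner_cov_eq_neg (hM : IsLeviCivita covM)
    {X Y : ∀ p : M, TangentSpace 𝓘(ℝ, E) p} (hX : IsSmoothField X) (hY : IsSmoothField Y)
    (hXY : ∀ p, (inner ℝ (X p) (Y p) : ℝ) = 0) {p : M} (z : TangentSpace 𝓘(ℝ, E) p) :
    (inner ℝ (covM X p z) (Y p) : ℝ) = -inner ℝ (X p) (covM Y p z) := by
  have h := hM.metric X Y p (hX.isDiffFieldAt p) (hY.isDiffFieldAt p) z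
  simp only [hXY, mvfderiv_const, _root_.zero_apply] at h
  linarith

end SemiSlantSubmanifold

end SemiSlant

end

/-! ### The two equivalences -/

theorem theorem3p4
    {E : Type*} [NormedAddCommGroup E] [NormedSpace ℝ E] [FiniteDimensional ℝ E]
    {E₁ : Type*} [NormedAddCommGroup E₁] [NormedSpace ℝ E₁] [FiniteDimensional ℝ E₁]
    -- the Kaehler manifold `N`
    {N : Type*} [TopologicalSpace N] [T2Space N] [SecondCountableTopology N]
    [ChartedSpace E₁ N] [IsManifold 𝓘(ℝ, E₁) ∞ N]
    [RiemannianBundle (fun q : N ↦ TangentSpace 𝓘(ℝ, E₁) q)]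
    [IsContMDiffRiemannianBundle 𝓘(ℝ, E₁) ∞ E₁ (fun q : N ↦ TangentSpace 𝓘(ℝ, E₁) q)]
    (J : ∀ q : N, TangentSpace 𝓘(ℝ, E₁) q →L[ℝ] TangentSpace 𝓘(ℝ, E₁) q)
    (covN : CovariantDerivative 𝓘(ℝ, E₁) E₁ (fun q : N ↦ TangentSpace 𝓘(ℝ, E₁) q))
    (hN : SemiSlant.IsKaehler J covN)
    -- the submanifold `M`, with the induced metric and its Levi-Civita connection
    {M : Type*} [TopologicalSpace M] [T2Space M] [SecondCountableTopology M]
    [ChartedSpace E M] [IsManifold 𝓘(ℝ, E) ∞ M]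
    [RiemannianBundle (fun p : M ↦ TangentSpace 𝓘(ℝ, E) p)]
    [IsContMDiffRiemannianBundle 𝓘(ℝ, E) ∞ E (fun p : M ↦ TangentSpace 𝓘(ℝ, E) p)]
    (ι : M → N) (hι : SemiSlant.IsIsometricImmersion (E := E) (E₁ := E₁) ι)
    (covM : CovariantDerivative 𝓘(ℝ, E) E (fun p : M ↦ TangentSpace 𝓘(ℝ, E) p))
    (hM : SemiSlant.IsLeviCivita covM)
    -- `M` is a proper pointwise semi-slant submanifold
    (DT Dθ : ∀ p : M, Submodule ℝ (TangentSpace 𝓘(ℝ, E) p)) (m₁ m₂ : ℕ) (θ : M → ℝ)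
    (hD : SemiSlant.IsProperPointwiseSemiSlant J ι DT Dθ m₁ m₂ θ)
    -- the complex points have empty interior
    (hθ : Dense {p : M | Real.sin (θ p) ≠ 0}) :
    (SemiSlant.IsTotallyGeodesicFoliation covM DT ↔
      ∀ X Y V : ∀ p : M, TangentSpace 𝓘(ℝ, E) p,
        SemiSlant.IsSectionOf DT X → SemiSlant.IsSectionOf DT Y → SemiSlant.IsSectionOf Dθ V →
        ∀ p : M,
          inner ℝ (SemiSlant.secondForm covN ι X Y p)
              (SemiSlant.norJ J ι p (SemiSlant.tanJ J ι p (V p))) =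
            inner ℝ (SemiSlant.secondForm covN ι X (fun q ↦ SemiSlant.tanJ J ι q (Y q)) p)
              (SemiSlant.norJ J ι p (V p))) ∧
    (SemiSlant.IsTotallyGeodesicFoliation covM Dθ ↔
      ∀ X U V : ∀ p : M, TangentSpace 𝓘(ℝ, E) p,
        SemiSlant.IsSectionOf DT X → SemiSlant.IsSectionOf Dθ U → SemiSlant.IsSectionOf Dθ V →
        ∀ p : M,
          inner ℝ (SemiSlant.secondForm covN ι U X p)
              (SemiSlant.norJ J ι p (SemiSlant.tanJ J ι p (V p))) =
            inner ℝ (SemiSlant.secondForm covN ι U (fun q ↦ SemiSlant.tanJ J ι q (X q)) p)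
              (SemiSlant.norJ J ι p (V p))) := by
  have hD' := hD.toIsPointwiseSemiSlant
  have horth (p : M) : Dθ p ⟂ DT p := (hD'.orthogonal p).symm
  have htop (p : M) : Dθ p ⊔ DT p = ⊤ := sup_comm (DT p) (Dθ p) ▸ hD'.sup_eq_top p
  refine ⟨⟨fun h X Y V hX hY hV p ↦ ?_, fun h ↦ hM.isTotallyGeodesicFoliation
    fun X Y hX hY p ↦ ?_⟩, ⟨fun h X U V hX hU hV p ↦ ?_, fun h ↦ hM.isTotallyGeodesicFoliation
    fun U V hU hV p ↦ ?_⟩⟩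
  · have h1 := hD'.sin_sq_mul_inner_cov hN hι hM X hY (hV.2 p)
    have h2 : (inner ℝ (covM Y p (X p)) (V p) : ℝ) = 0 :=
      (hD'.orthogonal p).inner_eq (h.cov_mem hX hY p) (hV.2 p)
    rw [h2, mul_zero] at h1
    exact (sub_eq_zero.1 h1).symm
  -- Membership in `DT` is tested against `Dθ`, each vector of which extends to a global section.
  · refine SemiSlant.mem_of_forall_inner_eq_zero (horth p) (htop p) fun v hv ↦ ?_
    obtain ⟨V, hV, rfl⟩ := hD'.distribution_θ.exists_isSectionOf hv
    rw [real_inner_comm]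
    exact hD'.inner_cov_eq_zero hN hι hM hθ hX.1 hY hV (h X Y V hX hY hV) p
  -- The key identity concerns `∇_U X`; metric compatibility turns it into a statement on `∇_U V`.
  · have h1 := hD'.sin_sq_mul_inner_cov hN hι hM U hX (hV.2 p)
    have h2 : (inner ℝ (covM X p (U p)) (V p) : ℝ) = 0 := by
      rw [hM.inner_cov_eq_neg hX.1 hV.1 (fun q ↦ (hD'.orthogonal q).inner_eq (hX.2 q) (hV.2 q)),
        neg_eq_zero]
      exact (hD'.orthogonal p).inner_eq (hX.2 p) (h.cov_mem hU hV p)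
    rw [h2, mul_zero] at h1
    exact (sub_eq_zero.1 h1).symm
  · refine SemiSlant.mem_of_forall_inner_eq_zero (hD'.orthogonal p) (hD'.sup_eq_top p)
      fun x hx ↦ ?_
    obtain ⟨X, hX, rfl⟩ := hD'.distribution_T.exists_isSectionOf hx
    have h1 := hD'.inner_cov_eq_zero hN hι hM hθ hU.1 hX hV (h X U V hX hU hV) p
    rw [hM.inner_cov_eq_neg hX.1 hV.1
      (fun q ↦ (hD'.orthogonal q).inner_eq (hX.2 q) (hV.2 q))] at h1
    exact neg_eq_zero.1 h1
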